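/- **Notation.** Let $\mathbb K=\mathbb R$ or $\mathbb C$. For a matrix $A$ over $\mathbb K$ let $A^T$, $A^H$, $\overline A$ denote its transpose, conjugate transpose and entrywise conjugate, $A^\dagger$ its Moore–Penrose pseudoinverse, $\|A\|_F$ its Frobenius norm and $\|A\|_2$ its spectral norm. For a positive semidefinite matrix $M$, $M^{1/2}$ is its positive semidefinite square root and $M^{-1/2}$ denotes $(M^{1/2})^{-1}$, with the inverse replaced by the pseudoinverse $(M^{1/2})^\dagger$ when $M$ is singular. Let $\mathsf{sym}$, $\mathsf{skew\text{-}sym}$, $\mathsf{Herm}$ be the sets of $A\in\mathbb K^{n\times n}$ with $A^T=A$, $A^T=-A$, $A^H=A$, respectively. For $\mathbb S\subseteq\mathbb K^{n\times n}$ and $X,B\in\mathbb K^{n\times p}$ put $$\mathbb S(X,B)=\{A\in\mathbb S: AX=B\},\qquad \sigma^{\mathbb S}(X,B)=\inf\{\|A\|:A\in\mathbb S(X,B)\},$$ where $\|\cdot\|$ is the norm under consideration, and let $\sigma^{\rm unstruc}(X,B)$ be $\sigma^{\mathbb S}(X,B)$ for $\mathbb S=\mathbb K^{n\times n}$. Define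 $$\mathcal F(X,B)=\begin{cases} BX^\dagger+(BX^\dagger)^T-(X^\dagger)^TX^TBX^\dagger, & \mathbb S=\mathsf{sym},\\ BX^\dagger-(BX^\dagger)^T-(X^\dagger)^TX^TBX^\dagger, & \mathbb S=\mathsf{skew\text{-}sym},\\ BX^\dagger+(BX^\dagger)^H-(X^\dagger)^HX^HBX^\dagger, & \mathbb S=\mathsf{Herm}.\end{cases}$$ **Theorem.** Let $X,B\in\mathbb K^{n\times p}$, let $\mathbb S\in\{\mathsf{sym},\mathsf{skew\text{-}sym},\mathsf{Herm}\}$ and suppose $\mathbb S(X,B)\neq\emptyset$. Then $A\in\mathbb S(X,B)$ if and only if, for some $Z\in\mathbb S$, $$A=\begin{cases}\mathcal F(X,B)+(I-XX^\dagger)^TZ(I-XX^\dagger), & \mathbb S\in\{\mathsf{sym},\mathsf{skew\text{-}sym}\},\\ \mathcal F(X,B)+(I-XX^\dagger)Z(I-XX^\dagger), & \mathbb S=\mathsf{Herm}.\end{cases}$$ (a) *Frobenius norm.* $A_o:=\mathcal F(X,B)$ is the unique matrix in $\mathbb S(X,B)$ with $\|A_o\|_F=\sigma^{\mathbb S}(X,B)$,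 and $$\sigma^{\mathbb S}(X,B)=\|A_o\|_F=\begin{cases}\sqrt{2\|BX^\dagger\|_F^2-\mathrm{Tr}\big(BX^\dagger(BX^\dagger)^H(XX^\dagger)^T\big)}, & \mathbb S\in\{\mathsf{sym},\mathsf{skew\text{-}sym}\},\\ \sqrt{2\|BX^\dagger\|_F^2-\mathrm{Tr}\big(BX^\dagger(BX^\dagger)^HXX^\dagger\big)}, & \mathbb S=\mathsf{Herm}\end{cases}$$ (the trace is real and the radicand nonnegative). (b) *Spectral norm.* $\sigma^{\mathbb S}(X,B)=\|BX^\dagger\|_2=\sigma^{\rm unstruc}(X,B)$. Moreover, let $r=\mathrm{rank}(X)$, let $X=U\Sigma V^H$ be any singular value decomposition ($U\in\mathbb K^{n\times n}$ and $V\in\mathbb K^{p\times p}$ unitary, $\Sigma$ diagonal with nonnegative, nonincreasing diagonal entries), partition $U=[U_1\ U_2]$ with $U_1\in\mathbb K^{n\times r}$, and put $\mu=\|BX^\dagger\|_2$. *Case I:* $\mathbb S\in\{\mathsf{sym},\mathsf{skew\text{-}sym}\}$. Let $K=BX^\dagger U_1\,(\mu^2I\mp U_1^H\overline{BX^\dagger}BX^\dagger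 U_1)^{-1/2}$, with sign $-$ for $\mathsf{sym}$ and $+$ for $\mathsf{skew\text{-}sym}$. For every $Z\in\mathbb K^{(n-r)\times(n-r)}$ with $\|Z\|_2\le1$ and $Z^T=Z$ (resp. $Z^T=-Z$) when $\mathbb S=\mathsf{sym}$ (resp. $\mathsf{skew\text{-}sym}$), the matrix $$A_o=\mathcal F(X,B)-(I-XX^\dagger)^TKU_1^H\overline{BX^\dagger U_1}K^T(I-XX^\dagger)+\mu\,\overline{U_2}\,(I-U_2^TKK^H\overline{U_2})^{1/2}Z(I-U_2^H\overline KK^TU_2)^{1/2}U_2^H$$ satisfies $A_o\in\mathbb S(X,B)$ and $\|A_o\|_2=\sigma^{\mathbb S}(X,B)$. *Case II:* $\mathbb S=\mathsf{Herm}$. Let $K=BX^\dagger U_1\,(\mu^2I-U_1^HBX^\dagger BX^\dagger U_1)^{-1/2}$. For every $Z\in\mathbb K^{(n-r)\times(n-r)}$ with $\|Z\|_2\le1$ and $Z^H=Z$, the matrix $$A_o=\mathcal F(X,B)-(I-XX^\dagger)KU_1^HBX^\dagger U_1K^H(I-XX^\dagger)+\mu\,U_2\,(I-U_2^HKK^HU_2)^{1/2}Z(I-U_2^HKK^HU_2)^{1/2}U_2^H$$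 satisfies $A_o\in\mathbb S(X,B)$ and $\|A_o\|_2=\sigma^{\mathbb S}(X,B)$. -/

import Mathlib

open scoped Matrix

noncomputable section

namespace StructMap

variable {𝕜 : Type*} [RCLike 𝕜]

/-- The four Penrose equations: `G` is the Moore-Penrose pseudoinverse of `A`. -/
structure IsMoorePenrose {m n : ℕ} (A : Matrix (Fin m) (Fin n) 𝕜)
    (G : Matrix (Fin n) (Fin m) 𝕜) : Prop where
  mul_mul_self : A * G * A = A
  mul_mul_inv : G * A * G = G
  isHermitian_left : (A * G)ᴴ = A * G
  isHermitian_right : (G * A)ᴴ = G * A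

open scoped ComplexOrder in
theorem exists_isMoorePenrose {m n : ℕ} (A : Matrix (Fin m) (Fin n) 𝕜) :
    ∃ G, IsMoorePenrose A G := by
  have hH : (Aᴴ * A).IsHermitian := Matrix.isHermitian_conjTranspose_mul_self A
  obtain ⟨W, hMW, hWH, hWMW, hcomm⟩ : ∃ W : Matrix (Fin n) (Fin n) 𝕜,
      (Aᴴ * A) * W * (Aᴴ * A) = Aᴴ * A ∧ Wᴴ = W ∧ W * (Aᴴ * A) * W = W ∧
        (Aᴴ * A) * W = W * (Aᴴ * A) := by
    have hsp := hH.spectral_theorem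
    rw [Unitary.conjStarAlgAut_apply] at hsp
    set U : Matrix (Fin n) (Fin n) 𝕜 := (hH.eigenvectorUnitary : Matrix (Fin n) (Fin n) 𝕜)
    have hU : star U * U = 1 := Unitary.coe_star_mul_self hH.eigenvectorUnitary
    set d : Fin n → 𝕜 := RCLike.ofReal ∘ hH.eigenvalues with hd
    have key : ∀ D E F : Matrix (Fin n) (Fin n) 𝕜,
        (U * D * star U) * (U * E * star U) * (U * F * star U) = U * (D * E * F) * star U := by
      intro D E F
      calc _ = U * D * (star U * U) * E * (star U * U) * F * star U := by
            simp only [Matrix.mul_assoc]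
        _ = _ := by rw [hU]; simp only [Matrix.mul_assoc, Matrix.mul_one]
    have key2 : ∀ D E : Matrix (Fin n) (Fin n) 𝕜,
        (U * D * star U) * (U * E * star U) = U * (D * E) * star U := by
      intro D E
      calc _ = U * D * (star U * U) * E * star U := by simp only [Matrix.mul_assoc]
        _ = _ := by rw [hU]; simp only [Matrix.mul_assoc, Matrix.mul_one]
    have h0 : ∀ x : 𝕜, x * x⁻¹ * x = x := mul_inv_mul_cancel
    refine ⟨U * Matrix.diagonal (fun i => (d i)⁻¹) * star U, ?_, ?_, ?_, ?_⟩
    · rw [hsp, key, Matrix.diagonal_mul_diagonal, Matrix.diagonal_mul_diagonal]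
      simp only [h0]
    · simp only [Matrix.star_eq_conjTranspose, Matrix.conjTranspose_mul,
        Matrix.conjTranspose_conjTranspose, Matrix.diagonal_conjTranspose, Matrix.mul_assoc]
      congr 3
      funext i
      simp [hd]
    · rw [hsp, key, Matrix.diagonal_mul_diagonal, Matrix.diagonal_mul_diagonal]
      congr 3
      funext i
      simpa using h0 (d i)⁻¹
    · rw [hsp, key2, key2, Matrix.diagonal_mul_diagonal, Matrix.diagonal_mul_diagonal]
      simp only [mul_comm]
  have hA : A * (W * (Aᴴ * A)) = A := by
    have h : Aᴴ * A * (W * (Aᴴ * A) - 1) = 0 := by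
      rw [Matrix.mul_sub, Matrix.mul_one, ← Matrix.mul_assoc, hMW, sub_self]
    rw [Matrix.conjTranspose_mul_self_mul_eq_zero, Matrix.mul_sub, Matrix.mul_one,
      sub_eq_zero] at h
    exact h
  refine ⟨W * Aᴴ, ?_, ?_, ?_, ?_⟩
  · simpa only [Matrix.mul_assoc] using hA
  · calc W * Aᴴ * A * (W * Aᴴ) = (W * (Aᴴ * A) * W) * Aᴴ := by simp only [Matrix.mul_assoc]
      _ = W * Aᴴ := by rw [hWMW]
  · simp only [Matrix.conjTranspose_mul, Matrix.conjTranspose_conjTranspose, hWH,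
      Matrix.mul_assoc]
  · rw [Matrix.mul_assoc, ← hcomm]
    simp only [Matrix.conjTranspose_mul, Matrix.conjTranspose_conjTranspose, hWH, hcomm]

theorem IsMoorePenrose.unique {m n : ℕ} {A : Matrix (Fin m) (Fin n) 𝕜}
    {G G' : Matrix (Fin n) (Fin m) 𝕜} (h : IsMoorePenrose A G) (h' : IsMoorePenrose A G') :
    G = G' := by
  have h1 : A * G = A * G' := by
    calc A * G = (A * G' * A) * G := by rw [h'.mul_mul_self]
      _ = (A * G')ᴴ * (A * G)ᴴ := by
        rw [h.isHermitian_left, h'.isHermitian_left]; simp only [Matrix.mul_assoc]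
      _ = ((A * G * A) * G')ᴴ := by rw [← Matrix.conjTranspose_mul]; simp only [Matrix.mul_assoc]
      _ = A * G' := by rw [h.mul_mul_self, h'.isHermitian_left]
  have h2 : G * A = G' * A := by
    calc G * A = G * (A * G' * A) := by rw [h'.mul_mul_self]
      _ = (G * A)ᴴ * (G' * A)ᴴ := by
        rw [h.isHermitian_right, h'.isHermitian_right]; simp only [Matrix.mul_assoc]
      _ = (G' * (A * G * A))ᴴ := by rw [← Matrix.conjTranspose_mul]; simp only [Matrix.mul_assoc]
      _ = G' * A := by rw [h.mul_mul_self, h'.isHermitian_right]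
  calc G = G * A * G := h.mul_mul_inv.symm
    _ = G' * (A * G) := by rw [h2, Matrix.mul_assoc]
    _ = G' * A * G' := by rw [h1, Matrix.mul_assoc]
    _ = G' := h'.mul_mul_inv

/-- The Moore-Penrose pseudoinverse of a matrix. -/
def pinv {m n : ℕ} (A : Matrix (Fin m) (Fin n) 𝕜) : Matrix (Fin n) (Fin m) 𝕜 :=
  (exists_isMoorePenrose A).choose

theorem pinv_spec {m n : ℕ} (A : Matrix (Fin m) (Fin n) 𝕜) : IsMoorePenrose A (pinv A) :=
  (exists_isMoorePenrose A).choose_spec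

open scoped Matrix.Norms.Frobenius in
/-- The Frobenius norm. -/
def frobNorm {m n : ℕ} (A : Matrix (Fin m) (Fin n) 𝕜) : ℝ := ‖A‖

open scoped Matrix.Norms.L2Operator in
/-- The spectral norm (the operator norm for the Euclidean norms). -/
def specNorm {m n : ℕ} (A : Matrix (Fin m) (Fin n) 𝕜) : ℝ := ‖A‖

open scoped MatrixOrder in
/-- The positive semidefinite square root of a positive semidefinite matrix. -/
def psdSqrt {n : ℕ} (A : Matrix (Fin n) (Fin n) 𝕜) : Matrix (Fin n) (Fin n) 𝕜 := CFC.sqrt A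

/-- The power `A ^ (-1/2)` of a positive semidefinite matrix, the inverse being read as the
Moore-Penrose pseudoinverse when `A` is singular. -/
def psdInvSqrt {n : ℕ} (A : Matrix (Fin n) (Fin n) 𝕜) : Matrix (Fin n) (Fin n) 𝕜 :=
  pinv (psdSqrt A)

/-- Entrywise complex conjugate. -/
def conj {m n : ℕ} (A : Matrix (Fin m) (Fin n) 𝕜) : Matrix (Fin m) (Fin n) 𝕜 :=
  A.map (starRingEnd 𝕜)

/-- The three classes of structured matrices. -/
inductive StructClass
  | sym
  | skewSym
  | herm

/-- The set of `n × n` matrices of the given class. -/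
def StructClass.matrices (𝕜 : Type*) [RCLike 𝕜] (n : ℕ) :
    StructClass → Set (Matrix (Fin n) (Fin n) 𝕜)
  | .sym => {A | Aᵀ = A}
  | .skewSym => {A | Aᵀ = -A}
  | .herm => {A | Aᴴ = A}

/-- `𝕊(X, B)`: all `A ∈ 𝕊` with `A X = B`. -/
def solutions {n p : ℕ} (S : Set (Matrix (Fin n) (Fin n) 𝕜)) (X B : Matrix (Fin n) (Fin p) 𝕜) :
    Set (Matrix (Fin n) (Fin n) 𝕜) :=
  {A | A ∈ S ∧ A * X = B}

/-- `σ^𝕊(X, B)`: the infimum of the norm `N` over `𝕊(X, B)`. -/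
def sigma {n p : ℕ} (N : Matrix (Fin n) (Fin n) 𝕜 → ℝ) (S : Set (Matrix (Fin n) (Fin n) 𝕜))
    (X B : Matrix (Fin n) (Fin p) 𝕜) : ℝ :=
  sInf (N '' solutions S X B)

/-- `𝓕_T(X, B)` (classes `sym` and `skewSym`) and `𝓕_H(X, B)` (class `herm`). -/
def solMap {n p : ℕ} (S : StructClass) (X B : Matrix (Fin n) (Fin p) 𝕜) :
    Matrix (Fin n) (Fin n) 𝕜 :=
  match S with
  | .sym => B * pinv X + (B * pinv X)ᵀ - (pinv X)ᵀ * (Xᵀ * B) * pinv X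
  | .skewSym => B * pinv X - (B * pinv X)ᵀ - (pinv X)ᵀ * (Xᵀ * B) * pinv X
  | .herm => B * pinv X + (B * pinv X)ᴴ - (pinv X)ᴴ * (Xᴴ * B) * pinv X

/-- `Pᵀ` for the classes `sym` and `skewSym`, and `P` itself for the class `herm`. -/
def StructClass.twist {n : ℕ} (S : StructClass) (P : Matrix (Fin n) (Fin n) 𝕜) :
    Matrix (Fin n) (Fin n) 𝕜 :=
  match S with
  | .sym => Pᵀ
  | .skewSym => Pᵀ
  | .herm => P

/-- `X = U Σ Vᴴ` is a singular value decomposition: `U`, `V` are unitary and `Σ` is (rectangular)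
diagonal with nonnegative, nonincreasing diagonal entries. -/
structure IsSVD {n p : ℕ} (X : Matrix (Fin n) (Fin p) 𝕜) (U : Matrix (Fin n) (Fin n) 𝕜)
    (Sig : Matrix (Fin n) (Fin p) 𝕜) (V : Matrix (Fin p) (Fin p) 𝕜) : Prop where
  unitary_left : U ∈ Matrix.unitaryGroup (Fin n) 𝕜
  unitary_right : V ∈ Matrix.unitaryGroup (Fin p) 𝕜
  diag : ∃ s : ℕ → ℝ, (∀ i, 0 ≤ s i) ∧ Antitone s ∧
    ∀ (i : Fin n) (j : Fin p), Sig i j = if (i : ℕ) = (j : ℕ) then ((s i : ℝ) : 𝕜) else 0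
  eq_mul : X = U * Sig * Vᴴ

theorem rank_le_rows {n p : ℕ} (X : Matrix (Fin n) (Fin p) 𝕜) : X.rank ≤ n := by
  simpa using X.rank_le_card_height

/-- The first `r` columns of `U`. -/
def firstCols {n r : ℕ} (h : r ≤ n) (U : Matrix (Fin n) (Fin n) 𝕜) : Matrix (Fin n) (Fin r) 𝕜 :=
  Matrix.of fun i j => U i ⟨j, lt_of_lt_of_le j.2 h⟩

/-- The last `n - r` columns of `U`. -/
def lastCols {n r : ℕ} (h : r ≤ n) (U : Matrix (Fin n) (Fin n) 𝕜) :
    Matrix (Fin n) (Fin (n - r)) 𝕜 :=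
  Matrix.of fun i j => U i ⟨r + j, by have := j.2; omega⟩

/-- The matrix `K`, with `G = B X†`, `μ = ‖B X†‖₂` and `U₁` the first `rank X` columns of `U`. -/
def dilK {n p r : ℕ} (S : StructClass) (X B : Matrix (Fin n) (Fin p) 𝕜)
    (U₁ : Matrix (Fin n) (Fin r) 𝕜) : Matrix (Fin n) (Fin r) 𝕜 :=
  let G := B * pinv X
  let μ : 𝕜 := ((specNorm G : ℝ) : 𝕜)
  match S with
  | .sym => G * U₁ * psdInvSqrt (μ ^ 2 • 1 - U₁ᴴ * conj G * G * U₁)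
  | .skewSym => G * U₁ * psdInvSqrt (μ ^ 2 • 1 + U₁ᴴ * conj G * G * U₁)
  | .herm => G * U₁ * psdInvSqrt (μ ^ 2 • 1 - U₁ᴴ * G * G * U₁)

/-- The matrix `A_o` of the spectral norm problem, for a partition `[U₁ U₂]` of the left factor of
an SVD of `X` and a contraction `Z`. -/
def dilSol {n p r q : ℕ} (S : StructClass) (X B : Matrix (Fin n) (Fin p) 𝕜)
    (U₁ : Matrix (Fin n) (Fin r) 𝕜) (U₂ : Matrix (Fin n) (Fin q) 𝕜)
    (Z : Matrix (Fin q) (Fin q) 𝕜) : Matrix (Fin n) (Fin n) 𝕜 :=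
  let G := B * pinv X
  let μ : 𝕜 := ((specNorm G : ℝ) : 𝕜)
  let K := dilK S X B U₁
  let Q := 1 - X * pinv X
  match S with
  | .herm =>
      solMap .herm X B - Q * K * U₁ᴴ * (G * U₁) * Kᴴ * Q
        + μ • (U₂ * psdSqrt (1 - U₂ᴴ * K * Kᴴ * U₂) * Z
            * psdSqrt (1 - U₂ᴴ * K * Kᴴ * U₂) * U₂ᴴ)
  | .sym | .skewSym =>
      solMap S X B - Qᵀ * K * U₁ᴴ * conj (G * U₁) * Kᵀ * Q
        + μ • (conj U₂ * psdSqrt (1 - U₂ᵀ * K * Kᴴ * conj U₂) * Z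
            * psdSqrt (1 - U₂ᴴ * conj K * Kᵀ * U₂) * U₂ᴴ)

end StructMap

end

/-! Write `adj` for the anti-multiplicative involution of the class and `ε = sgn` for its sign, so
that `A` is structured iff `adj A = ε A`; the three cases then become one. Put `P = X X†`, `Q = 1 -
P`, `G = B X†`. A solution satisfies `A P = G`, hence `adj P * A = ε adj G`. Three of its four
blocks with respect to `P`, `Q` are thus prescribed, and `𝓕(X, B)` is `A` with the free corner `adj
Q * A * Q` removed (`solMap_eq_sub_of_mem`). This gives the parametrization. The blocks are
Frobenius-orthogonal, so Pythagoras makes the zero corner the unique minimizer. For the spectral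
norm, `‖G‖ = ‖A P‖ ≤ ‖A‖` is the lower bound. Attaining it is a norm-preserving dilation problem. In
the frames `[cj U₁, cj U₂]` and `[U₁, U₂]` a solution reads `[a, ε adj b; b, y]`, with `a` and `b`
the compressions of `G` and `μ = ‖G‖`. Since the first column has norm at most `μ`, `b = K₂ M` with
`M = (μ² - aᴴ a)^{1/2}` and `K₂ = adj U₂ * K` a contraction. As `adj a = ε a`, the other defect root
is `N = adj M` and `ε adj b = N L` with `L = ε adj K₂`. The Davis–Kahan–Weinberger corner `y = -K₂
aᴴ L + μ R Z T` keeps the norm at most `μ` (`l2_opNorm_dilation_le`) and is structured when `Z` is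
(`dilSol_mem`). The singular value decomposition enters only through `U₁ U₁ᴴ = P` and `U₂ U₂ᴴ = Q`.
-/

open scoped Matrix

noncomputable section

namespace StructMap

variable {𝕜 : Type*} [RCLike 𝕜]

/-! ### Involution and sign treating the three classes uniformly -/

namespace StructClass

variable {l m n : Type*}

/-- The anti-multiplicative involution attached to a class: the transpose for `sym` and `skewSym`,
the conjugate transpose for `herm`. -/
def adj (S : StructClass) (A : Matrix m n 𝕜) : Matrix n m 𝕜 :=
  match S with
  | .sym => Aᵀ
  | .skewSym => Aᵀ
  | .herm => Aᴴ

/-- The multiplicative involution attached to a class: entrywise conjugation for `sym` and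
`skewSym`, the identity for `herm`. -/
def cj (S : StructClass) (A : Matrix m n 𝕜) : Matrix m n 𝕜 := (S.adj A)ᴴ

/-- The sign `ε` such that the matrices of the class are those with `adj A = ε A`. -/
def sgn (𝕜 : Type*) [RCLike 𝕜] (S : StructClass) : 𝕜 :=
  match S with
  | .sym => 1
  | .skewSym => -1
  | .herm => 1

variable (S : StructClass)

theorem mem_matrices_iff {k : ℕ} {A : Matrix (Fin k) (Fin k) 𝕜} :
    A ∈ S.matrices 𝕜 k ↔ S.adj A = S.sgn 𝕜 • A := by
  cases S <;> simp [matrices, adj, sgn]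

theorem sgn_mul_sgn : S.sgn 𝕜 * S.sgn 𝕜 = 1 := by cases S <;> simp [sgn]

theorem star_sgn : star (S.sgn 𝕜) = S.sgn 𝕜 := by cases S <;> simp [sgn]

theorem sgn_smul_sgn_smul (A : Matrix m n 𝕜) : S.sgn 𝕜 • S.sgn 𝕜 • A = A := by
  rw [smul_smul, sgn_mul_sgn, one_smul]

@[simp]
theorem adj_mul [Fintype m] (A : Matrix l m 𝕜) (B : Matrix m n 𝕜) :
    S.adj (A * B) = S.adj B * S.adj A := by
  cases S <;> simp [adj]

@[simp]
theorem adj_add (A B : Matrix m n 𝕜) : S.adj (A + B) = S.adj A + S.adj B := by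
  cases S <;> simp [adj]

@[simp]
theorem adj_sub (A B : Matrix m n 𝕜) : S.adj (A - B) = S.adj A - S.adj B := by
  cases S <;> simp [adj]

@[simp]
theorem adj_adj (A : Matrix m n 𝕜) : S.adj (S.adj A) = A := by
  cases S <;> simp [adj]

@[simp]
theorem adj_one [DecidableEq n] : S.adj (1 : Matrix n n 𝕜) = 1 := by
  cases S <;> simp [adj]

@[simp]
theorem adj_zero : S.adj (0 : Matrix m n 𝕜) = 0 := by
  cases S <;> simp [adj]

theorem adj_smul_of_star_eq {c : 𝕜} (hc : star c = c) (A : Matrix m n 𝕜) :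
    S.adj (c • A) = c • S.adj A := by
  cases S <;> simp only [adj, Matrix.transpose_smul, Matrix.conjTranspose_smul, hc]

@[simp]
theorem adj_sgn_smul (A : Matrix m n 𝕜) : S.adj (S.sgn 𝕜 • A) = S.sgn 𝕜 • S.adj A :=
  S.adj_smul_of_star_eq S.star_sgn A

@[simp]
theorem adj_conjTranspose (A : Matrix m n 𝕜) : S.adj Aᴴ = S.cj A := by
  cases S <;> rfl

theorem conjTranspose_adj (A : Matrix m n 𝕜) : (S.adj A)ᴴ = S.cj A := rfl

@[simp]
theorem conjTranspose_cj (A : Matrix m n 𝕜) : (S.cj A)ᴴ = S.adj A := by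
  simp [cj]

@[simp]
theorem adj_cj (A : Matrix m n 𝕜) : S.adj (S.cj A) = Aᴴ := by
  rw [← adj_conjTranspose, adj_adj]

@[simp]
theorem cj_mul [Fintype m] (A : Matrix l m 𝕜) (B : Matrix m n 𝕜) :
    S.cj (A * B) = S.cj A * S.cj B := by
  simp [cj]

@[simp]
theorem cj_conjTranspose (A : Matrix m n 𝕜) : S.cj Aᴴ = S.adj A := by
  simp [cj]

@[simp]
theorem cj_adj (A : Matrix m n 𝕜) : S.cj (S.adj A) = Aᴴ := by
  simp [cj]

/-- Needed for the Hermitian projections `X X†` and `1 - X X†`, where `Pᴴ = P` reconciles the two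
conventions in the class `herm`. -/
theorem twist_eq_adj {k : ℕ} {P : Matrix (Fin k) (Fin k) 𝕜} (hP : Pᴴ = P) :
    S.twist P = S.adj P := by
  cases S <;> simp [twist, adj, hP]

open scoped ComplexOrder in
theorem adj_posSemidef {A : Matrix n n 𝕜} (hA : A.PosSemidef) : (S.adj A).PosSemidef := by
  cases S
  exacts [hA.transpose, hA.transpose, hA.conjTranspose]

end StructClass

/-! ### Frobenius norm and orthogonality -/

section Frobenius

variable {k l : ℕ}

open scoped Matrix.Norms.Frobenius in
theorem frobNorm_nonneg (A : Matrix (Fin k) (Fin l) 𝕜) : 0 ≤ frobNorm A := norm_nonneg _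

open scoped Matrix.Norms.Frobenius in
theorem frobNorm_eq_zero_iff {A : Matrix (Fin k) (Fin l) 𝕜} : frobNorm A = 0 ↔ A = 0 :=
  norm_eq_zero

open scoped Matrix.Norms.Frobenius in
theorem ofReal_frobNorm_sq (A : Matrix (Fin k) (Fin l) 𝕜) :
    ((frobNorm A ^ 2 : ℝ) : 𝕜) = (Aᴴ * A).trace := by
  have h0 : 0 ≤ ∑ i, ∑ j, ‖A i j‖ ^ (2 : ℝ) := by positivity
  rw [frobNorm, Matrix.frobenius_norm_def, ← Real.sqrt_eq_rpow, Real.sq_sqrt h0, Finset.sum_comm]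
  simp [Matrix.trace, Matrix.mul_apply, RCLike.conj_mul]

open scoped Matrix.Norms.Frobenius in
theorem frobNorm_adj (S : StructClass) (A : Matrix (Fin k) (Fin l) 𝕜) :
    frobNorm (S.adj A) = frobNorm A := by
  cases S
  exacts [Matrix.frobenius_norm_transpose A, Matrix.frobenius_norm_transpose A,
    Matrix.frobenius_norm_conjTranspose A]

/-- Pythagoras for the Frobenius inner product. -/
theorem frobNorm_add_sq {A B : Matrix (Fin k) (Fin l) 𝕜} (h : (Aᴴ * B).trace = 0) :
    frobNorm (A + B) ^ 2 = frobNorm A ^ 2 + frobNorm B ^ 2 := by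
  have h' : (Bᴴ * A).trace = 0 := by
    rw [← Matrix.conjTranspose_conjTranspose A, ← Matrix.conjTranspose_mul,
      Matrix.trace_conjTranspose, h, star_zero]
  apply RCLike.ofReal_injective (K := 𝕜)
  rw [RCLike.ofReal_add, ofReal_frobNorm_sq, ofReal_frobNorm_sq, ofReal_frobNorm_sq]
  simp [Matrix.add_mul, Matrix.mul_add, h, h']

end Frobenius

/-! ### Spectral norm bounds as semidefiniteness -/

section Spectral

open scoped Matrix.Norms.L2Operator ComplexOrder

variable {m n : Type*} [Fintype m] [Fintype n]

theorem star_dotProduct_self_eq_norm_sq (x : EuclideanSpace 𝕜 n) :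
    star x.ofLp ⬝ᵥ x.ofLp = ((‖x‖ ^ 2 : ℝ) : 𝕜) := by
  rw [EuclideanSpace.norm_sq_eq]
  simp [dotProduct, RCLike.conj_mul]

theorem eq_zero_of_posSemidef_neg {A : Matrix m n 𝕜} (h : (-(Aᴴ * A)).PosSemidef) : A = 0 := by
  rw [← Matrix.trace_conjTranspose_mul_self_eq_zero_iff]
  apply le_antisymm
  · simpa using h.trace_nonneg
  · exact (Matrix.posSemidef_conjTranspose_mul_self A).trace_nonneg

variable [DecidableEq n]

/-- A matrix has spectral norm at most `c` iff `c² - AᴴA` is positive semidefinite. -/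
theorem l2_opNorm_le_iff_posSemidef (A : Matrix m n 𝕜) {c : ℝ} (hc : 0 ≤ c) :
    ‖A‖ ≤ c ↔ ((c : 𝕜) ^ 2 • (1 : Matrix n n 𝕜) - Aᴴ * A).PosSemidef := by
  -- The quadratic form of the defect at `x` is `c² ‖x‖² - ‖A x‖²`.
  have key : ∀ x : EuclideanSpace 𝕜 n,
      star x.ofLp ⬝ᵥ (((c : 𝕜) ^ 2 • (1 : Matrix n n 𝕜) - Aᴴ * A) *ᵥ x.ofLp) =
        (((c * ‖x‖) ^ 2 - ‖WithLp.toLp 2 (A *ᵥ x.ofLp)‖ ^ 2 : ℝ) : 𝕜) := by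
    intro x
    have h2 := star_dotProduct_self_eq_norm_sq (WithLp.toLp 2 (A *ᵥ x.ofLp))
    rw [Matrix.sub_mulVec, dotProduct_sub, Matrix.smul_mulVec, Matrix.one_mulVec,
      dotProduct_smul, star_dotProduct_self_eq_norm_sq, ← Matrix.mulVec_mulVec, Matrix.dotProduct_mulVec,
      Matrix.vecMul_conjTranspose, star_star, h2]
    push_cast
    simp [mul_pow]
  have hiff : (∀ x : EuclideanSpace 𝕜 n, ‖WithLp.toLp 2 (A *ᵥ x.ofLp)‖ ≤ c * ‖x‖) ↔ ‖A‖ ≤ c :=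
    ⟨fun h => ContinuousLinearMap.opNorm_le_bound _ hc h,
      fun h x => (Matrix.l2_opNorm_mulVec A x).trans (by gcongr)⟩
  rw [← hiff, Matrix.posSemidef_iff_dotProduct_mulVec]
  have hH : ((c : 𝕜) ^ 2 • (1 : Matrix n n 𝕜) - Aᴴ * A).IsHermitian := by
    simp [Matrix.IsHermitian]
  simp only [hH, true_and]
  constructor
  · intro h x
    rw [key (WithLp.toLp 2 x)]
    rw [RCLike.ofReal_nonneg, sub_nonneg]
    have := h (WithLp.toLp 2 x)
    gcongr
  · intro h x
    have := h x.ofLp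
    rw [key x, RCLike.ofReal_nonneg, sub_nonneg] at this
    exact le_of_sq_le_sq this (by positivity)

theorem l2_opNorm_le_one_iff_posSemidef (A : Matrix m n 𝕜) :
    ‖A‖ ≤ 1 ↔ ((1 : Matrix n n 𝕜) - Aᴴ * A).PosSemidef := by
  simpa using l2_opNorm_le_iff_posSemidef A zero_le_one

theorem l2_opNorm_le_one_iff_posSemidef' [DecidableEq m] (A : Matrix m n 𝕜) :
    ‖A‖ ≤ 1 ↔ ((1 : Matrix m m 𝕜) - A * Aᴴ).PosSemidef := by
  rw [← Matrix.l2_opNorm_conjTranspose, l2_opNorm_le_one_iff_posSemidef,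
    Matrix.conjTranspose_conjTranspose]

end Spectral

/-! ### Positive semidefinite square roots -/

section Sqrt

open scoped MatrixOrder ComplexOrder

variable {k : ℕ}

theorem psdSqrt_posSemidef (A : Matrix (Fin k) (Fin k) 𝕜) : (psdSqrt A).PosSemidef :=
  Matrix.nonneg_iff_posSemidef.1 (CFC.sqrt_nonneg A)

theorem psdSqrt_mul_psdSqrt {A : Matrix (Fin k) (Fin k) 𝕜} (hA : A.PosSemidef) :
    psdSqrt A * psdSqrt A = A :=
  CFC.sqrt_mul_sqrt_self A hA.nonneg

theorem conjTranspose_psdSqrt (A : Matrix (Fin k) (Fin k) 𝕜) : (psdSqrt A)ᴴ = psdSqrt A :=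
  (psdSqrt_posSemidef A).isHermitian

theorem adj_psdSqrt (S : StructClass) {A : Matrix (Fin k) (Fin k) 𝕜} (hA : A.PosSemidef) :
    S.adj (psdSqrt A) = psdSqrt (S.adj A) := by
  symm
  apply CFC.sqrt_unique
  · rw [← S.adj_mul, psdSqrt_mul_psdSqrt hA]
  · exact (S.adj_posSemidef (psdSqrt_posSemidef A)).nonneg

/-- A matrix intertwining two positive semidefinite matrices intertwines their square roots. -/
theorem mul_psdSqrt_eq_psdSqrt_mul {A P Q : Matrix (Fin k) (Fin k) 𝕜} (hP : P.PosSemidef)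
    (hQ : Q.PosSemidef) (h : A * P = Q * A) : A * psdSqrt P = psdSqrt Q * A := by
  set p := psdSqrt P
  set q := psdSqrt Q
  have hp : p * p = P := psdSqrt_mul_psdSqrt hP
  have hq : q * q = Q := psdSqrt_mul_psdSqrt hQ
  have hpH : pᴴ = p := conjTranspose_psdSqrt P
  have hqH : qᴴ = q := conjTranspose_psdSqrt Q
  obtain ⟨b, hb⟩ := CStarAlgebra.nonneg_iff_eq_star_mul_self.mp (psdSqrt_posSemidef P).nonneg
  obtain ⟨d, hd⟩ := CStarAlgebra.nonneg_iff_eq_star_mul_self.mp (psdSqrt_posSemidef Q).nonneg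
  rw [Matrix.star_eq_conjTranspose] at hb hd
  -- The error `X` solves the Sylvester equation `q X + X p = 0`. Pairing it with `X` under the
  -- trace gives two nonnegative terms with sum zero, hence `q X = 0` and `X p = 0`, even when `p`
  -- and `q` are singular.
  set X := A * p - q * A with hX
  have hsyl : q * X + X * p = 0 := by
    rw [hX, Matrix.mul_sub, Matrix.sub_mul, Matrix.mul_assoc A, hp, ← Matrix.mul_assoc q q, hq, h]
    simp only [Matrix.mul_assoc]
    abel
  have e1 : (d * X)ᴴ * (d * X) = Xᴴ * q * X := by
    simp only [Matrix.conjTranspose_mul, Matrix.mul_assoc, q, hd]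
  have e2 : ((X * bᴴ)ᴴ * (X * bᴴ)).trace = (Xᴴ * X * p).trace := by
    rw [Matrix.conjTranspose_mul, Matrix.conjTranspose_conjTranspose, Matrix.mul_assoc,
      Matrix.trace_mul_comm]
    simp only [Matrix.mul_assoc, p, hb]
  have hsum : ((d * X)ᴴ * (d * X)).trace + ((X * bᴴ)ᴴ * (X * bᴴ)).trace = 0 := by
    rw [e1, e2, ← Matrix.trace_add, Matrix.mul_assoc, Matrix.mul_assoc, ← Matrix.mul_add, hsyl,
      Matrix.mul_zero, Matrix.trace_zero]
  have hz := (add_eq_zero_iff_of_nonneg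
    (Matrix.posSemidef_conjTranspose_mul_self (d * X)).trace_nonneg
    (Matrix.posSemidef_conjTranspose_mul_self (X * bᴴ)).trace_nonneg).1 hsum
  have hdX : d * X = 0 := Matrix.trace_conjTranspose_mul_self_eq_zero_iff.1 hz.1
  have hXb : X * bᴴ = 0 := Matrix.trace_conjTranspose_mul_self_eq_zero_iff.1 hz.2
  have hqX : q * X = 0 := by
    simp only [q, hd, Matrix.mul_assoc]; rw [hdX, Matrix.mul_zero]
  have hXp : X * p = 0 := by
    simp only [p, hb, ← Matrix.mul_assoc]; rw [hXb, Matrix.zero_mul]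
  -- Since `q X = 0`, `Xᴴ X = p Aᴴ X`, and `X p = 0` kills its product with `X`.
  have hXX : X * (Xᴴ * X) = 0 := by
    have : Xᴴ * X = p * Aᴴ * X := by
      conv_lhs => rw [hX]
      rw [Matrix.conjTranspose_sub, Matrix.conjTranspose_mul, Matrix.conjTranspose_mul, hpH, hqH,
        Matrix.sub_mul, Matrix.mul_assoc Aᴴ, hqX, Matrix.mul_zero, sub_zero]
    rw [this, ← Matrix.mul_assoc, ← Matrix.mul_assoc, hXp, Matrix.zero_mul, Matrix.zero_mul]
  have : Xᴴ * X * (Xᴴ * X) = 0 := by rw [Matrix.mul_assoc, hXX, Matrix.mul_zero]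
  have hX0 : X = 0 := by
    have h2 : Xᴴ * X = 0 := by
      rw [← Matrix.conjTranspose_mul_self_eq_zero, Matrix.conjTranspose_mul,
        Matrix.conjTranspose_conjTranspose, this]
    exact Matrix.conjTranspose_mul_self_eq_zero.1 h2
  exact sub_eq_zero.1 hX0

end Sqrt

/-! ### Norm-preserving dilations -/

section Dilation

open scoped Matrix.Norms.L2Operator ComplexOrder

variable {n r q : Type*} [Fintype n] [Fintype r] [Fintype q] [DecidableEq n] [DecidableEq r]
  [DecidableEq q]

/-- The block matrix `diag ([A, N; M, -Aᴴ], μ Z)` has norm at most `μ` if `N`, `M` are defect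
operators of `A` and `Z` is a contraction. -/
theorem l2_opNorm_julia_le {μ : ℝ} (hμ : 0 ≤ μ) {A M N : Matrix r r 𝕜} {Z : Matrix q q 𝕜}
    (hM : Mᴴ = M) (hN : Nᴴ = N)
    (hMM : M * M = (μ : 𝕜) ^ 2 • (1 : Matrix r r 𝕜) - Aᴴ * A)
    (hNN : N * N = (μ : 𝕜) ^ 2 • (1 : Matrix r r 𝕜) - A * Aᴴ)
    (hAM : A * M = N * A) (hZ : ‖Z‖ ≤ 1) :
    ‖Matrix.fromBlocks (Matrix.fromBlocks A N M (-Aᴴ)) 0 0 ((μ : 𝕜) • Z)‖ ≤ μ := by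
  have hAM' : M * Aᴴ = Aᴴ * N := by
    have := congrArg Matrix.conjTranspose hAM
    simpa [hM, hN] using this
  rw [l2_opNorm_le_iff_posSemidef _ hμ]
  -- The defect of the block matrix vanishes on both `r`-blocks and equals `μ² (1 - Zᴴ Z)` on the
  -- `q`-block.
  have hZ' := ((l2_opNorm_le_one_iff_posSemidef Z).1 hZ).smul
    (show (0 : 𝕜) ≤ (μ : 𝕜) ^ 2 by rw [← RCLike.ofReal_pow, RCLike.ofReal_nonneg]; positivity)
  have h := hZ'.conjTranspose_mul_mul_same
    (Matrix.fromCols 0 1 : Matrix q ((r ⊕ r) ⊕ q) 𝕜)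
  convert h using 1
  rw [← Matrix.fromBlocks_one, ← Matrix.fromBlocks_one, Matrix.fromBlocks_smul,
    Matrix.fromBlocks_smul, Matrix.fromBlocks_conjTranspose, Matrix.fromBlocks_conjTranspose,
    Matrix.fromBlocks_multiply, Matrix.fromBlocks_multiply,
    Matrix.conjTranspose_fromCols_eq_fromRows_conjTranspose, Matrix.fromRows_mul,
    Matrix.fromRows_mul_fromCols]
  ext (( i | i) | i) ((j | j) | j) <;>
    simp [hM, hN, hMM, hNN, hAM, hAM', mul_sub, smul_smul, pow_two, RCLike.real_smul_eq_coe_mul]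

/-- The sufficiency half of the theorem of Davis, Kahan and Weinberger on norm-preserving
dilations, with respect to frames `[V₁ V₂]` and `[U₁ U₂]`. -/
theorem l2_opNorm_dilation_le {μ : ℝ} (hμ : 0 ≤ μ) {A M N : Matrix r r 𝕜} {Z T R : Matrix q q 𝕜}
    {K : Matrix q r 𝕜} {L : Matrix r q 𝕜} {V₁ U₁ : Matrix n r 𝕜} {V₂ U₂ : Matrix n q 𝕜}
    (hV : V₁ * V₁ᴴ + V₂ * V₂ᴴ = 1) (hU : U₁ * U₁ᴴ + U₂ * U₂ᴴ = 1)
    (hM : Mᴴ = M) (hN : Nᴴ = N)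
    (hMM : M * M = (μ : 𝕜) ^ 2 • (1 : Matrix r r 𝕜) - Aᴴ * A)
    (hNN : N * N = (μ : 𝕜) ^ 2 • (1 : Matrix r r 𝕜) - A * Aᴴ)
    (hAM : A * M = N * A) (hZ : ‖Z‖ ≤ 1) (hR : R * Rᴴ = 1 - K * Kᴴ) (hT : Tᴴ * T = 1 - Lᴴ * L) :
    ‖V₁ * A * U₁ᴴ + V₁ * (N * L) * U₂ᴴ + V₂ * (K * M) * U₁ᴴ +
      V₂ * (-(K * Aᴴ * L) + (μ : 𝕜) • (R * Z * T)) * U₂ᴴ‖ ≤ μ := by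
  have hrow : ‖Matrix.fromCols (Matrix.fromCols V₁ (V₂ * K)) (V₂ * R)‖ ≤ 1 := by
    rw [l2_opNorm_le_one_iff_posSemidef']
    convert Matrix.PosSemidef.zero using 1
    rw [Matrix.conjTranspose_fromCols_eq_fromRows_conjTranspose, Matrix.fromCols_mul_fromRows,
      Matrix.conjTranspose_fromCols_eq_fromRows_conjTranspose, Matrix.fromCols_mul_fromRows]
    have : V₂ * K * (V₂ * K)ᴴ + V₂ * R * (V₂ * R)ᴴ = V₂ * (K * Kᴴ + R * Rᴴ) * V₂ᴴ := by
      simp only [Matrix.conjTranspose_mul, Matrix.mul_add, Matrix.add_mul, Matrix.mul_assoc]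
    rw [add_assoc, this, hR, add_sub_cancel, Matrix.mul_one, hV, sub_self]
  have hcol : ‖Matrix.fromRows (Matrix.fromRows U₁ᴴ (L * U₂ᴴ)) (T * U₂ᴴ)‖ ≤ 1 := by
    rw [l2_opNorm_le_one_iff_posSemidef]
    convert Matrix.PosSemidef.zero using 1
    rw [Matrix.conjTranspose_fromRows_eq_fromCols_conjTranspose, Matrix.fromCols_mul_fromRows,
      Matrix.conjTranspose_fromRows_eq_fromCols_conjTranspose, Matrix.fromCols_mul_fromRows]
    have : (L * U₂ᴴ)ᴴ * (L * U₂ᴴ) + (T * U₂ᴴ)ᴴ * (T * U₂ᴴ) = U₂ * (Lᴴ * L + Tᴴ * T) * U₂ᴴ := by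
      simp only [Matrix.conjTranspose_mul, Matrix.conjTranspose_conjTranspose, Matrix.mul_add,
        Matrix.add_mul, Matrix.mul_assoc]
    rw [add_assoc, this, hT, add_sub_cancel, Matrix.mul_one, Matrix.conjTranspose_conjTranspose,
      hU, sub_self]
  have hmid := l2_opNorm_julia_le hμ hM hN hMM hNN hAM hZ
  -- The dilation is a coisometry times the block matrix above times an isometry.
  have hfac : V₁ * A * U₁ᴴ + V₁ * (N * L) * U₂ᴴ + V₂ * (K * M) * U₁ᴴ +
      V₂ * (-(K * Aᴴ * L) + (μ : 𝕜) • (R * Z * T)) * U₂ᴴ =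
      Matrix.fromCols (Matrix.fromCols V₁ (V₂ * K)) (V₂ * R) *
        Matrix.fromBlocks (Matrix.fromBlocks A N M (-Aᴴ)) 0 0 ((μ : 𝕜) • Z) *
        Matrix.fromRows (Matrix.fromRows U₁ᴴ (L * U₂ᴴ)) (T * U₂ᴴ) := by
    rw [Matrix.fromCols_mul_fromBlocks, Matrix.fromCols_mul_fromBlocks, Matrix.fromCols_mul_fromRows,
      Matrix.mul_zero, Matrix.mul_zero, add_zero, zero_add, Matrix.fromCols_mul_fromRows]
    simp only [Matrix.mul_add, Matrix.add_mul, Matrix.mul_neg, Matrix.neg_mul, Matrix.mul_smul,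
      Matrix.smul_mul, Matrix.mul_assoc]
    abel
  rw [hfac]
  calc _ ≤ _ := Matrix.l2_opNorm_mul _ _
    _ ≤ (_ * _) * _ := by gcongr; exact Matrix.l2_opNorm_mul _ _
    _ ≤ (1 * μ) * 1 := by gcongr
    _ = μ := by ring

end Dilation

/-! ### Factoring through a possibly singular defect operator -/

section PinvContraction

open scoped Matrix.Norms.L2Operator ComplexOrder

variable {r q : ℕ}

/-- Factorization of `b` through the defect operator `M` when `bᴴ b ≤ M²`. -/
theorem mul_pinv_mul_self_of_posSemidef {M : Matrix (Fin r) (Fin r) 𝕜}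
    {b : Matrix (Fin q) (Fin r) 𝕜} (h : (M * M - bᴴ * b).PosSemidef) :
    b * pinv M * M = b := by
  have hE : M * (1 - pinv M * M) = 0 := by
    -- `E = 1 - M† M` is annihilated by `M`, so conjugating the hypothesis by `E` leaves `-(b E)ᴴ (b
    -- E)` positive semidefinite, forcing `b E = 0`.
    rw [Matrix.mul_sub, Matrix.mul_one, ← Matrix.mul_assoc, (pinv_spec M).mul_mul_self, sub_self]
  have h0 : b * (1 - pinv M * M) = 0 := by
    apply eq_zero_of_posSemidef_neg
    generalize 1 - pinv M * M = E at hE ⊢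
    have := h.conjTranspose_mul_mul_same E
    rw [Matrix.mul_sub, Matrix.sub_mul, Matrix.mul_assoc _ (M * M), Matrix.mul_assoc M, hE,
      Matrix.mul_zero, Matrix.mul_zero, zero_sub] at this
    simpa only [Matrix.conjTranspose_mul, Matrix.mul_assoc] using this
  rw [Matrix.mul_sub, Matrix.mul_one, sub_eq_zero] at h0
  rw [Matrix.mul_assoc, ← h0]

/-- `1 - (b M†)ᴴ (b M†)` is the sum of the projection `1 - M M†` and the conjugate of `M² - bᴴ b` by
`M†`. -/
theorem l2_opNorm_mul_pinv_le_one {M : Matrix (Fin r) (Fin r) 𝕜} (hM : Mᴴ = M)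
    {b : Matrix (Fin q) (Fin r) 𝕜} (h : (M * M - bᴴ * b).PosSemidef) :
    ‖b * pinv M‖ ≤ 1 := by
  rw [l2_opNorm_le_one_iff_posSemidef]
  have hs := pinv_spec M
  have hE : (1 - M * pinv M)ᴴ * (1 - M * pinv M) = 1 - M * pinv M := by
    rw [Matrix.conjTranspose_sub, Matrix.conjTranspose_one, hs.isHermitian_left, Matrix.mul_sub,
      Matrix.mul_one, Matrix.sub_mul, Matrix.one_mul, ← Matrix.mul_assoc, hs.mul_mul_self]
    simp
  have h1 := Matrix.posSemidef_conjTranspose_mul_self (1 - M * pinv M)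
  have hMM : (pinv M)ᴴ * (M * M) * pinv M = M * pinv M := by
    calc (pinv M)ᴴ * (M * M) * pinv M = (M * pinv M)ᴴ * (M * pinv M) := by
          rw [Matrix.conjTranspose_mul, hM]; simp only [Matrix.mul_assoc]
      _ = M * pinv M * M * pinv M := by rw [hs.isHermitian_left]; simp only [Matrix.mul_assoc]
      _ = M * pinv M := by rw [hs.mul_mul_self]
  rw [hE] at h1
  convert h1.add (h.conjTranspose_mul_mul_same (pinv M)) using 1
  rw [Matrix.mul_sub, Matrix.sub_mul, hMM, Matrix.conjTranspose_mul]
  simp only [Matrix.mul_assoc]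
  abel

end PinvContraction

/-! ### The projections `X X†` and `1 - X X†` -/

section Projection

variable {n p : ℕ} (X : Matrix (Fin n) (Fin p) 𝕜)

theorem mul_pinv_idem : X * pinv X * (X * pinv X) = X * pinv X := by
  rw [← Matrix.mul_assoc, (pinv_spec X).mul_mul_self]

theorem one_sub_mul_pinv_mul_self : (1 - X * pinv X) * X = 0 := by
  rw [Matrix.sub_mul, (pinv_spec X).mul_mul_self, Matrix.one_mul, sub_self]

theorem conjTranspose_one_sub_mul_pinv : (1 - X * pinv X)ᴴ = 1 - X * pinv X := by
  rw [Matrix.conjTranspose_sub, Matrix.conjTranspose_one, (pinv_spec X).isHermitian_left]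

theorem one_sub_mul_pinv_idem : (1 - X * pinv X) * (1 - X * pinv X) = 1 - X * pinv X := by
  rw [Matrix.mul_sub, Matrix.mul_one, Matrix.sub_mul, Matrix.one_mul, mul_pinv_idem]
  simp

open scoped ComplexOrder in
/-- If `U Uᴴ = P` is an orthogonal projection, then `P U = U`. -/
theorem mul_eq_self_of_mul_conjTranspose {m k : Type*} [Fintype m] [Fintype k] [DecidableEq m]
    {P : Matrix m m 𝕜} {U : Matrix m k 𝕜} (hU : U * Uᴴ = P) (hP : P * P = P) :
    P * U = U := by
  have h : (1 - P) * U = 0 := by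
    rw [← Matrix.self_mul_conjTranspose_eq_zero, Matrix.conjTranspose_mul, Matrix.mul_assoc,
      ← Matrix.mul_assoc U, hU, ← Matrix.mul_assoc, Matrix.sub_mul, Matrix.one_mul, hP, sub_self,
      Matrix.zero_mul]
  rw [Matrix.sub_mul, Matrix.one_mul, sub_eq_zero] at h
  exact h.symm

end Projection

/-! ### Parametrization and the Frobenius minimizer -/

section Solutions

variable {n p : ℕ} (S : StructClass) {X B : Matrix (Fin n) (Fin p) 𝕜}

theorem solMap_eq (X B : Matrix (Fin n) (Fin p) 𝕜) :
    solMap S X B = B * pinv X + S.sgn 𝕜 • S.adj (B * pinv X)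
      - S.adj (X * pinv X) * (B * pinv X) := by
  cases S <;>
    simp [solMap, StructClass.sgn, StructClass.adj, Matrix.mul_assoc, sub_eq_add_neg]

theorem mem_solutions_iff {A : Matrix (Fin n) (Fin n) 𝕜} :
    A ∈ solutions (S.matrices 𝕜 n) X B ↔ S.adj A = S.sgn 𝕜 • A ∧ A * X = B := by
  rw [solutions, Set.mem_ofPred_eq, S.mem_matrices_iff]

variable {S} {A : Matrix (Fin n) (Fin n) 𝕜}

theorem mul_pinv_eq_of_mem (hA : A ∈ solutions (S.matrices 𝕜 n) X B) :
    B * pinv X = A * (X * pinv X) := by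
  rw [← hA.2, Matrix.mul_assoc]

theorem sgn_smul_adj_mul_pinv (hA : A ∈ solutions (S.matrices 𝕜 n) X B) :
    S.sgn 𝕜 • S.adj (B * pinv X) = S.adj (X * pinv X) * A := by
  rw [mul_pinv_eq_of_mem hA, S.adj_mul, ((mem_solutions_iff S).1 hA).1, Matrix.mul_smul,
    S.sgn_smul_sgn_smul]

/-- In terms of `A`, the map is `A P + adj P * A - adj P * A * P`, which is everything but the
corner cut out by `1 - P`. -/
theorem solMap_eq_sub_of_mem (hA : A ∈ solutions (S.matrices 𝕜 n) X B) :
    solMap S X B = A - S.adj (1 - X * pinv X) * A * (1 - X * pinv X) := by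
  rw [solMap_eq, sgn_smul_adj_mul_pinv hA, mul_pinv_eq_of_mem hA, S.adj_sub, S.adj_one]
  simp only [Matrix.sub_mul, Matrix.mul_sub, Matrix.one_mul, Matrix.mul_one, Matrix.mul_assoc]
  abel

theorem solMap_add_mem (hA : A ∈ solutions (S.matrices 𝕜 n) X B)
    {Z : Matrix (Fin n) (Fin n) 𝕜} (hZ : S.adj Z = S.sgn 𝕜 • Z) :
    solMap S X B + S.adj (1 - X * pinv X) * Z * (1 - X * pinv X)
      ∈ solutions (S.matrices 𝕜 n) X B := by
  obtain ⟨hA1, hA2⟩ := (mem_solutions_iff S).1 hA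
  rw [mem_solutions_iff, solMap_eq_sub_of_mem hA]
  constructor
  · simp only [S.adj_add, S.adj_sub (A := A), S.adj_mul, S.adj_adj, hA1, hZ, smul_add, smul_sub,
      Matrix.mul_smul, Matrix.smul_mul, Matrix.mul_assoc]
  · rw [Matrix.add_mul, Matrix.sub_mul, Matrix.mul_assoc _ _ X, Matrix.mul_assoc _ _ X,
      one_sub_mul_pinv_mul_self, Matrix.mul_zero, Matrix.mul_zero, sub_zero, add_zero, hA2]

theorem solMap_mem (hA : A ∈ solutions (S.matrices 𝕜 n) X B) :
    solMap S X B ∈ solutions (S.matrices 𝕜 n) X B := by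
  simpa using solMap_add_mem hA (Z := 0) (by simp)

theorem mem_solutions_iff_exists (hne : (solutions (S.matrices 𝕜 n) X B).Nonempty) :
    A ∈ solutions (S.matrices 𝕜 n) X B ↔ ∃ Z ∈ S.matrices 𝕜 n,
      A = solMap S X B + S.twist (1 - X * pinv X) * Z * (1 - X * pinv X) := by
  obtain ⟨A₀, hA₀⟩ := hne
  rw [S.twist_eq_adj (conjTranspose_one_sub_mul_pinv X)]
  constructor
  · intro hA
    -- A solution serves as its own parameter.
    exact ⟨A, hA.1, by rw [solMap_eq_sub_of_mem hA, sub_add_cancel]⟩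
  · rintro ⟨Z, hZ, rfl⟩
    exact solMap_add_mem hA₀ (S.mem_matrices_iff.1 hZ)

/-- The difference lives in the corner `adj Q * _ * Q`, where `solMap` has no component, so the two
summands are orthogonal. -/
theorem frobNorm_sq_eq_of_mem (hA : A ∈ solutions (S.matrices 𝕜 n) X B) :
    frobNorm A ^ 2 = frobNorm (solMap S X B) ^ 2 + frobNorm (A - solMap S X B) ^ 2 := by
  rw [← frobNorm_add_sq, add_sub_cancel]
  have hD : A - solMap S X B = S.adj (1 - X * pinv X) * A * (1 - X * pinv X) := by
    rw [solMap_eq_sub_of_mem hA, sub_sub_cancel]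
  have hQ := one_sub_mul_pinv_idem X
  have hQH := conjTranspose_one_sub_mul_pinv X
  have hF := solMap_eq_sub_of_mem hA
  rw [hD]
  clear hD
  generalize 1 - X * pinv X = Q at *
  have hQ' : S.adj Q * S.adj Q = S.adj Q := by rw [← S.adj_mul, hQ]
  have hQ'H : (S.adj Q)ᴴ = S.adj Q := by rw [S.conjTranspose_adj, ← S.adj_conjTranspose, hQH]
  have h0 : S.adj Q * solMap S X B * Q = 0 := by
    rw [hF, Matrix.mul_sub, Matrix.sub_mul, ← Matrix.mul_assoc, ← Matrix.mul_assoc, hQ',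
      Matrix.mul_assoc _ Q Q, hQ, sub_self]
  have h1 : Q * ((solMap S X B)ᴴ * S.adj Q) = 0 := by
    have := congrArg Matrix.conjTranspose h0
    simpa [Matrix.conjTranspose_mul, hQH, hQ'H] using this
  rw [← Matrix.mul_assoc, Matrix.trace_mul_comm, ← Matrix.mul_assoc, ← Matrix.mul_assoc,
    Matrix.mul_assoc Q, h1, Matrix.zero_mul, Matrix.trace_zero]

theorem frobNorm_solMap_le (hA : A ∈ solutions (S.matrices 𝕜 n) X B) :
    frobNorm (solMap S X B) ≤ frobNorm A := by
  apply le_of_sq_le_sq _ (frobNorm_nonneg A)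
  rw [frobNorm_sq_eq_of_mem hA]
  exact le_add_of_nonneg_right (sq_nonneg _)

theorem sigma_frobNorm (hne : (solutions (S.matrices 𝕜 n) X B).Nonempty) :
    sigma frobNorm (S.matrices 𝕜 n) X B = frobNorm (solMap S X B) := by
  obtain ⟨A₀, hA₀⟩ := hne
  refine IsLeast.csInf_eq ⟨Set.mem_image_of_mem _ (solMap_mem hA₀), ?_⟩
  rintro _ ⟨A, hA, rfl⟩
  exact frobNorm_solMap_le hA

theorem eq_solMap_of_frobNorm_eq (hA : A ∈ solutions (S.matrices 𝕜 n) X B)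
    (h : frobNorm A = frobNorm (solMap S X B)) : A = solMap S X B := by
  have := frobNorm_sq_eq_of_mem hA
  rw [h, left_eq_add, sq_eq_zero_iff, frobNorm_eq_zero_iff, sub_eq_zero] at this
  exact this

/-- Splitting columns by `P` gives `‖𝓕‖² = ‖G‖² + ‖adj P * A * Q‖²`. The same splitting of `ε adj G
= adj P * A`, which has the norm of `G`, gives `‖G‖² = ‖adj P * G‖² + ‖adj P * A * Q‖²`; eliminate
the common term. -/
theorem frobNorm_solMap_sq (hA : A ∈ solutions (S.matrices 𝕜 n) X B) :
    frobNorm (solMap S X B) ^ 2 =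
      2 * frobNorm (B * pinv X) ^ 2 - frobNorm (S.adj (X * pinv X) * (B * pinv X)) ^ 2 := by
  have hP := mul_pinv_idem X
  have hPH := (pinv_spec X).isHermitian_left
  have hG := mul_pinv_eq_of_mem hA
  have hGa := sgn_smul_adj_mul_pinv hA
  have hF := solMap_eq S X B
  set P := X * pinv X
  set G := B * pinv X
  have hGP : G * P = G := by rw [hG, Matrix.mul_assoc, hP]
  have hPG : P * Gᴴ = Gᴴ := by
    rw [← Matrix.conjTranspose_conjTranspose P, ← Matrix.conjTranspose_mul, hPH, hGP]
  have hP0 : (1 - P) * P = 0 := by rw [Matrix.sub_mul, Matrix.one_mul, hP, sub_self]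
  have hGF : solMap S X B = G + S.adj P * A * (1 - P) := by
    rw [hF, hGa, Matrix.mul_sub, Matrix.mul_one, Matrix.mul_assoc, ← hG]
    abel
  have horth : ∀ Y Y' : Matrix (Fin n) (Fin n) 𝕜, ((Y * P)ᴴ * (Y' * (1 - P))).trace = 0 := by
    intro Y Y'
    rw [← Matrix.mul_assoc, Matrix.trace_mul_comm, Matrix.conjTranspose_mul, hPH,
      ← Matrix.mul_assoc, ← Matrix.mul_assoc, hP0, Matrix.zero_mul, Matrix.zero_mul,
      Matrix.trace_zero]
  have h1 : frobNorm (solMap S X B) ^ 2 =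
      frobNorm G ^ 2 + frobNorm (S.adj P * A * (1 - P)) ^ 2 := by
    rw [hGF, frobNorm_add_sq]
    have := horth G (S.adj P * A)
    rwa [hGP] at this
  have h2 : frobNorm G ^ 2 =
      frobNorm (S.adj P * G) ^ 2 + frobNorm (S.adj P * A * (1 - P)) ^ 2 := by
    rw [← frobNorm_add_sq]
    · have : S.adj P * G + S.adj P * A * (1 - P) = S.sgn 𝕜 • S.adj G := by
        rw [hGa, Matrix.mul_sub, Matrix.mul_one, Matrix.mul_assoc, ← hG]
        abel
      rw [this]
      apply RCLike.ofReal_injective (K := 𝕜)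
      rw [← frobNorm_adj S G, ofReal_frobNorm_sq, ofReal_frobNorm_sq, Matrix.conjTranspose_smul,
        S.star_sgn, Matrix.smul_mul, Matrix.mul_smul, S.sgn_smul_sgn_smul]
    · have := horth (S.adj P * G) (S.adj P * A)
      rwa [Matrix.mul_assoc _ G, hGP] at this
  linarith

theorem ofReal_frobNorm_adj_mul_sq (X B : Matrix (Fin n) (Fin p) 𝕜) :
    ((frobNorm (S.adj (X * pinv X) * (B * pinv X)) ^ 2 : ℝ) : 𝕜) =
      (B * pinv X * (B * pinv X)ᴴ * S.twist (X * pinv X)).trace := by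
  have hPH := (pinv_spec X).isHermitian_left
  have hP := mul_pinv_idem X
  rw [S.twist_eq_adj hPH, ofReal_frobNorm_sq, Matrix.conjTranspose_mul, S.conjTranspose_adj,
    ← S.adj_conjTranspose, hPH, Matrix.mul_assoc _ (S.adj _), ← Matrix.mul_assoc (S.adj _),
    ← S.adj_mul, hP, ← Matrix.mul_assoc, Matrix.trace_mul_comm, ← Matrix.mul_assoc]

end Solutions

/-! ### The spectral norm and its minimizers -/

section SpectralSolutions

open scoped ComplexOrder Matrix.Norms.L2Operator

variable {n p r q : ℕ} (S : StructClass) (X B : Matrix (Fin n) (Fin p) 𝕜)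
  (U₁ : Matrix (Fin n) (Fin r) 𝕜) (U₂ : Matrix (Fin n) (Fin q) 𝕜)

theorem dilK_eq :
    dilK S X B U₁ = B * pinv X * U₁ * psdInvSqrt (((specNorm (B * pinv X) : ℝ) : 𝕜) ^ 2 • 1
      - S.sgn 𝕜 • (U₁ᴴ * S.cj (B * pinv X) * (B * pinv X) * U₁)) := by
  cases S
  · simp only [dilK, StructClass.sgn, one_smul]; rfl
  · simp only [dilK, StructClass.sgn, neg_smul, one_smul, sub_neg_eq_add]; rfl
  · simp only [dilK, StructClass.sgn, one_smul, StructClass.cj, StructClass.adj,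
      Matrix.conjTranspose_conjTranspose]

theorem dilSol_eq (Z : Matrix (Fin q) (Fin q) 𝕜) :
    dilSol S X B U₁ U₂ Z = solMap S X B
      - S.adj (1 - X * pinv X) * dilK S X B U₁ * U₁ᴴ * S.cj (B * pinv X * U₁)
          * S.adj (dilK S X B U₁) * (1 - X * pinv X)
      + ((specNorm (B * pinv X) : ℝ) : 𝕜) •
        (S.cj U₂ * psdSqrt (1 - S.adj U₂ * dilK S X B U₁ * (dilK S X B U₁)ᴴ * S.cj U₂) * Z
          * psdSqrt (1 - U₂ᴴ * S.cj (dilK S X B U₁) * S.adj (dilK S X B U₁) * U₂) * U₂ᴴ) := by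
  cases S
  · rfl
  · rfl
  · simp only [dilSol, StructClass.cj, StructClass.adj, Matrix.conjTranspose_conjTranspose,
      conjTranspose_one_sub_mul_pinv]

variable {S X B U₁ U₂} {A : Matrix (Fin n) (Fin n) 𝕜}

/-- The compression `a` of a solution to the range of `X`. -/
theorem adj_compression (hA : A ∈ solutions (S.matrices 𝕜 n) X B) (hU₁ : U₁ * U₁ᴴ = X * pinv X) :
    S.adj (S.adj U₁ * (B * pinv X) * U₁) = S.sgn 𝕜 • (S.adj U₁ * (B * pinv X) * U₁) := by
  have hPU := mul_eq_self_of_mul_conjTranspose hU₁ (mul_pinv_idem X)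
  have hG := mul_pinv_eq_of_mem hA
  have hA1 := ((mem_solutions_iff S).1 hA).1
  -- As `P U₁ = U₁`, `G` may be replaced by `A`, whose symmetry passes to the compression.
  have h : S.adj U₁ * (B * pinv X) * U₁ = S.adj U₁ * A * U₁ := by
    rw [hG, Matrix.mul_assoc, Matrix.mul_assoc A, hPU, ← Matrix.mul_assoc]
  rw [h]
  simp only [S.adj_mul, S.adj_adj, hA1, Matrix.mul_smul, Matrix.smul_mul, Matrix.mul_assoc]

theorem cj_compression (hA : A ∈ solutions (S.matrices 𝕜 n) X B) (hU₁ : U₁ * U₁ᴴ = X * pinv X) :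
    S.cj (S.adj U₁ * (B * pinv X) * U₁) = S.sgn 𝕜 • (S.adj U₁ * (B * pinv X) * U₁)ᴴ := by
  conv_lhs => rw [StructClass.cj, adj_compression hA hU₁, Matrix.conjTranspose_smul, S.star_sgn]

/-- Identifies the radicand in the definition of `K` as the defect `μ² - aᴴ a`, using `G = G U₁ U₁ᴴ`
and `cj a = ε aᴴ`. -/
theorem sgn_smul_gram_compression (hA : A ∈ solutions (S.matrices 𝕜 n) X B)
    (hU₁ : U₁ * U₁ᴴ = X * pinv X) :
    S.sgn 𝕜 • (U₁ᴴ * S.cj (B * pinv X) * (B * pinv X) * U₁) =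
      (S.adj U₁ * (B * pinv X) * U₁)ᴴ * (S.adj U₁ * (B * pinv X) * U₁) := by
  have h : U₁ᴴ * S.cj (B * pinv X) = S.cj (S.adj U₁ * (B * pinv X) * U₁) * S.adj U₁ := by
    have hGP : B * pinv X = B * pinv X * (U₁ * U₁ᴴ) := by
      rw [hU₁, mul_pinv_eq_of_mem hA, Matrix.mul_assoc, mul_pinv_idem]
    conv_lhs => rw [hGP]
    simp only [S.cj_mul, S.cj_adj, S.cj_conjTranspose, Matrix.mul_assoc]
  rw [h, cj_compression hA hU₁]
  simp only [Matrix.smul_mul, S.sgn_smul_sgn_smul, Matrix.mul_assoc]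

/-- The matrix `b = (adj U₂) G U₁` is dominated by the defect of the compression of `G`. -/
theorem posSemidef_defect_sub (hU₁ : U₁ * U₁ᴴ = X * pinv X)
    (hU₂ : U₂ * U₂ᴴ = 1 - X * pinv X) (G : Matrix (Fin n) (Fin n) 𝕜) :
    (((specNorm G : ℝ) : 𝕜) ^ 2 • (1 : Matrix (Fin r) (Fin r) 𝕜)
      - (S.adj U₁ * G * U₁)ᴴ * (S.adj U₁ * G * U₁)
      - (S.adj U₂ * G * U₁)ᴴ * (S.adj U₂ * G * U₁)).PosSemidef := by
  have hU : ‖U₁‖ ≤ 1 := by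
    rw [l2_opNorm_le_one_iff_posSemidef', hU₁, ← hU₂]
    exact Matrix.posSemidef_self_mul_conjTranspose U₂
  have hGU : ‖G * U₁‖ ≤ specNorm G :=
    (Matrix.l2_opNorm_mul G U₁).trans (mul_le_of_le_one_right (norm_nonneg _) hU)
  have hsum : S.cj U₁ * S.adj U₁ + S.cj U₂ * S.adj U₂ = 1 := by
    rw [← S.adj_conjTranspose, ← S.adj_conjTranspose, ← S.adj_mul, ← S.adj_mul, hU₁, hU₂,
      ← S.adj_add, add_sub_cancel, S.adj_one]
  have h := (l2_opNorm_le_iff_posSemidef (G * U₁) (norm_nonneg G)).1 hGU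
  have e : (G * U₁)ᴴ * (G * U₁) = (S.adj U₁ * G * U₁)ᴴ * (S.adj U₁ * G * U₁)
      + (S.adj U₂ * G * U₁)ᴴ * (S.adj U₂ * G * U₁) := by
    calc (G * U₁)ᴴ * (G * U₁)
        = (G * U₁)ᴴ * (S.cj U₁ * S.adj U₁ + S.cj U₂ * S.adj U₂) * (G * U₁) := by
          rw [hsum, Matrix.mul_one]
      _ = _ := by
          simp only [Matrix.conjTranspose_mul, Matrix.mul_add, Matrix.add_mul,
            S.conjTranspose_adj, Matrix.mul_assoc]
  rw [e, ← sub_sub] at h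
  exact h

theorem adj_psdSqrt_defect {K : Matrix (Fin q) (Fin r) 𝕜} (hK : (1 - K * Kᴴ).PosSemidef) :
    S.adj (psdSqrt (1 - K * Kᴴ)) = psdSqrt (1 - S.cj K * S.adj K) := by
  rw [adj_psdSqrt S hK, S.adj_sub, S.adj_one, S.adj_mul, S.adj_conjTranspose]

theorem adj_dilK_compression (hA : A ∈ solutions (S.matrices 𝕜 n) X B)
    (hU₁ : U₁ * U₁ᴴ = X * pinv X) :
    S.adj U₂ * dilK S X B U₁ = S.adj U₂ * (B * pinv X) * U₁ *
      pinv (psdSqrt (((specNorm (B * pinv X) : ℝ) : 𝕜) ^ 2 • 1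
        - (S.adj U₁ * (B * pinv X) * U₁)ᴴ * (S.adj U₁ * (B * pinv X) * U₁))) := by
  rw [dilK_eq, sgn_smul_gram_compression hA hU₁, psdInvSqrt]
  simp only [Matrix.mul_assoc]

theorem posSemidef_defect (hU₁ : U₁ * U₁ᴴ = X * pinv X)
    (hU₂ : U₂ * U₂ᴴ = 1 - X * pinv X) (G : Matrix (Fin n) (Fin n) 𝕜) :
    (((specNorm G : ℝ) : 𝕜) ^ 2 • (1 : Matrix (Fin r) (Fin r) 𝕜)
      - (S.adj U₁ * G * U₁)ᴴ * (S.adj U₁ * G * U₁)).PosSemidef := by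
  have := (posSemidef_defect_sub (S := S) hU₁ hU₂ G).add
    (Matrix.posSemidef_conjTranspose_mul_self (S.adj U₂ * G * U₁))
  rwa [sub_add_cancel] at this

theorem posSemidef_one_sub_dilK (hA : A ∈ solutions (S.matrices 𝕜 n) X B)
    (hU₁ : U₁ * U₁ᴴ = X * pinv X) (hU₂ : U₂ * U₂ᴴ = 1 - X * pinv X) :
    (1 - (S.adj U₂ * dilK S X B U₁) * (S.adj U₂ * dilK S X B U₁)ᴴ).PosSemidef := by
  rw [← l2_opNorm_le_one_iff_posSemidef', adj_dilK_compression hA hU₁]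
  apply l2_opNorm_mul_pinv_le_one (conjTranspose_psdSqrt _)
  rw [psdSqrt_mul_psdSqrt (posSemidef_defect hU₁ hU₂ _)]
  exact posSemidef_defect_sub hU₁ hU₂ _

/-- Recovers `b = K₂ M` even for singular `M`, since `bᴴ b ≤ M²`. -/
theorem dilK_compression_mul (hA : A ∈ solutions (S.matrices 𝕜 n) X B)
    (hU₁ : U₁ * U₁ᴴ = X * pinv X) (hU₂ : U₂ * U₂ᴴ = 1 - X * pinv X) :
    S.adj U₂ * dilK S X B U₁ * psdSqrt (((specNorm (B * pinv X) : ℝ) : 𝕜) ^ 2 • 1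
        - (S.adj U₁ * (B * pinv X) * U₁)ᴴ * (S.adj U₁ * (B * pinv X) * U₁)) =
      S.adj U₂ * (B * pinv X) * U₁ := by
  rw [adj_dilK_compression hA hU₁]
  apply mul_pinv_mul_self_of_posSemidef
  rw [psdSqrt_mul_psdSqrt (posSemidef_defect hU₁ hU₂ _)]
  exact posSemidef_defect_sub hU₁ hU₂ _

theorem adj_one_sub_mul_pinv (hU₂ : U₂ * U₂ᴴ = 1 - X * pinv X) :
    S.adj (1 - X * pinv X) = S.cj U₂ * S.adj U₂ := by
  rw [← hU₂, S.adj_mul, S.adj_conjTranspose]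

/-- The spectral solution in terms of the compressions `a` and `K₂ = (adj U₂) K`. -/
theorem dilSol_eq_compression (hA : A ∈ solutions (S.matrices 𝕜 n) X B)
    (hU₁ : U₁ * U₁ᴴ = X * pinv X) (hU₂ : U₂ * U₂ᴴ = 1 - X * pinv X)
    (Z : Matrix (Fin q) (Fin q) 𝕜) {K₂ : Matrix (Fin q) (Fin r) 𝕜}
    (hK₂ : S.adj U₂ * dilK S X B U₁ = K₂) {a : Matrix (Fin r) (Fin r) 𝕜}
    (ha : S.adj U₁ * (B * pinv X) * U₁ = a) :
    dilSol S X B U₁ U₂ Z = solMap S X B + S.cj U₂ * (-(K₂ * aᴴ * (S.sgn 𝕜 • S.adj K₂))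
      + ((specNorm (B * pinv X) : ℝ) : 𝕜) •
        (psdSqrt (1 - K₂ * K₂ᴴ) * Z * psdSqrt (1 - S.cj K₂ * S.adj K₂))) * U₂ᴴ := by
  have e1 : S.adj U₂ * dilK S X B U₁ * (dilK S X B U₁)ᴴ * S.cj U₂ = K₂ * K₂ᴴ := by
    rw [← hK₂, Matrix.conjTranspose_mul, S.conjTranspose_adj, ← Matrix.mul_assoc]
  have e2 : U₂ᴴ * S.cj (dilK S X B U₁) * S.adj (dilK S X B U₁) * U₂ = S.cj K₂ * S.adj K₂ := by
    rw [← hK₂, S.cj_mul, S.cj_adj, S.adj_mul, S.adj_adj, ← Matrix.mul_assoc]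
  have e3 : U₁ᴴ * S.cj (B * pinv X * U₁) = S.sgn 𝕜 • aᴴ := by
    rw [← ha, ← cj_compression hA hU₁, Matrix.mul_assoc (S.adj U₁), S.cj_mul (S.adj U₁), S.cj_adj]
  have e4 : S.adj (dilK S X B U₁) * (1 - X * pinv X) = S.adj K₂ * U₂ᴴ := by
    rw [← hU₂, ← hK₂, S.adj_mul, S.adj_adj, Matrix.mul_assoc]
  have e5 : S.adj (1 - X * pinv X) * dilK S X B U₁ = S.cj U₂ * K₂ := by
    rw [adj_one_sub_mul_pinv hU₂, Matrix.mul_assoc, hK₂]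
  rw [dilSol_eq, e1, e2, e5, Matrix.mul_assoc _ _ (1 - X * pinv X), e4,
    Matrix.mul_assoc _ U₁ᴴ, e3]
  simp only [Matrix.mul_add, Matrix.add_mul, Matrix.mul_neg, Matrix.neg_mul, Matrix.mul_smul,
    Matrix.smul_mul, Matrix.mul_assoc]
  abel

/-- The involution exchanges the two defect roots and `a` satisfies `adj a = ε a`, so the added
corner is structured. It is unchanged under compression by `1 - X X†`, hence an instance of the
general solution. -/
theorem dilSol_mem (hA : A ∈ solutions (S.matrices 𝕜 n) X B)
    (hU₁ : U₁ * U₁ᴴ = X * pinv X) (hU₂ : U₂ * U₂ᴴ = 1 - X * pinv X)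
    {Z : Matrix (Fin q) (Fin q) 𝕜} (hZ : Z ∈ S.matrices 𝕜 q) :
    dilSol S X B U₁ U₂ Z ∈ solutions (S.matrices 𝕜 n) X B := by
  have hK := posSemidef_one_sub_dilK hA hU₁ hU₂
  have haa := adj_compression hA hU₁
  rw [dilSol_eq_compression hA hU₁ hU₂ Z rfl rfl]
  generalize S.adj U₁ * (B * pinv X) * U₁ = a at *
  generalize S.adj U₂ * dilK S X B U₁ = K₂ at *
  have hca : S.cj a = S.sgn 𝕜 • aᴴ := by
    rw [StructClass.cj, haa, Matrix.conjTranspose_smul, S.star_sgn]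
  have hRT := adj_psdSqrt_defect (S := S) hK
  have hTR : S.adj (psdSqrt (1 - S.cj K₂ * S.adj K₂)) = psdSqrt (1 - K₂ * K₂ᴴ) := by
    rw [← hRT, S.adj_adj]
  set μ : 𝕜 := ((specNorm (B * pinv X) : ℝ) : 𝕜) with hμ
  have hμs : star μ = μ := by simp [hμ]
  set Y := -(K₂ * aᴴ * (S.sgn 𝕜 • S.adj K₂)) +
    μ • (psdSqrt (1 - K₂ * K₂ᴴ) * Z * psdSqrt (1 - S.cj K₂ * S.adj K₂)) with hY
  have hneg : ∀ M : Matrix (Fin q) (Fin q) 𝕜, S.adj (-M) = -S.adj M := by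
    intro M; rw [← zero_sub, S.adj_sub, S.adj_zero, zero_sub]
  have hYs : S.adj Y = S.sgn 𝕜 • Y := by
    rw [hY, S.adj_add, hneg, S.adj_smul_of_star_eq hμs]
    simp only [S.adj_mul, S.adj_sgn_smul, S.adj_adj, S.adj_conjTranspose, hca, hRT, hTR,
      S.mem_matrices_iff.1 hZ, smul_add, smul_neg, Matrix.mul_smul, Matrix.smul_mul,
      Matrix.mul_assoc, smul_comm μ]
  have hQU := mul_eq_self_of_mul_conjTranspose hU₂ (one_sub_mul_pinv_idem X)
  have hUQ : U₂ᴴ * (1 - X * pinv X) = U₂ᴴ := by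
    rw [← conjTranspose_one_sub_mul_pinv X, ← Matrix.conjTranspose_mul, hQU]
  have hcQ : S.adj (1 - X * pinv X) * S.cj U₂ = S.cj U₂ := by
    rw [← S.adj_conjTranspose, ← S.adj_mul, hUQ]
  have h := solMap_add_mem hA (Z := S.cj U₂ * Y * U₂ᴴ) (by
    simp only [S.adj_mul, S.adj_conjTranspose, S.adj_cj, hYs, Matrix.mul_smul, Matrix.smul_mul,
      Matrix.mul_assoc])
  rwa [← Matrix.mul_assoc, ← Matrix.mul_assoc, hcQ, Matrix.mul_assoc _ U₂ᴴ, hUQ] at h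

theorem specNorm_dilSol_le (hA : A ∈ solutions (S.matrices 𝕜 n) X B)
    (hU₁ : U₁ * U₁ᴴ = X * pinv X) (hU₂ : U₂ * U₂ᴴ = 1 - X * pinv X)
    {Z : Matrix (Fin q) (Fin q) 𝕜} (hZ : specNorm Z ≤ 1) :
    specNorm (dilSol S X B U₁ U₂ Z) ≤ specNorm (B * pinv X) := by
  have hK := posSemidef_one_sub_dilK hA hU₁ hU₂
  have hKM := dilK_compression_mul hA hU₁ hU₂
  have hMp := posSemidef_defect (S := S) hU₁ hU₂ (B * pinv X)
  have haa := adj_compression hA hU₁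
  have hcUU : S.cj U₁ * S.adj U₁ = S.adj (X * pinv X) := by
    rw [← hU₁, S.adj_mul, S.adj_conjTranspose]
  have hGP : B * pinv X * (X * pinv X) = B * pinv X := by
    rw [mul_pinv_eq_of_mem hA, Matrix.mul_assoc, mul_pinv_idem]
  have hcUV : S.cj U₂ * S.adj U₂ = 1 - S.adj (X * pinv X) := by
    rw [← adj_one_sub_mul_pinv hU₂, S.adj_sub, S.adj_one]
  have hblock₁ : S.cj U₁ * (S.adj U₁ * (B * pinv X) * U₁) * U₁ᴴ =
      S.adj (X * pinv X) * (B * pinv X) := by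
    rw [Matrix.mul_assoc, Matrix.mul_assoc _ U₁, hU₁, Matrix.mul_assoc, hGP, ← Matrix.mul_assoc,
      hcUU]
  have hblock₂ : S.cj U₂ * (S.adj U₂ * (B * pinv X) * U₁) * U₁ᴴ =
      B * pinv X - S.adj (X * pinv X) * (B * pinv X) := by
    rw [Matrix.mul_assoc, Matrix.mul_assoc _ U₁, hU₁, Matrix.mul_assoc, hGP, ← Matrix.mul_assoc,
      hcUV, Matrix.sub_mul, Matrix.one_mul]
  have hblock₃ : S.sgn 𝕜 • (S.adj (B * pinv X) - S.adj (B * pinv X) * (X * pinv X)) =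
      S.sgn 𝕜 • S.adj (B * pinv X) - S.adj (X * pinv X) * (B * pinv X) := by
    rw [smul_sub, ← Matrix.smul_mul, sgn_smul_adj_mul_pinv hA, Matrix.mul_assoc,
      ← mul_pinv_eq_of_mem hA]
  rw [dilSol_eq_compression hA hU₁ hU₂ Z rfl rfl, solMap_eq]
  have hFsplit : B * pinv X + S.sgn 𝕜 • S.adj (B * pinv X) - S.adj (X * pinv X) * (B * pinv X) =
      S.cj U₁ * (S.adj U₁ * (B * pinv X) * U₁) * U₁ᴴ
      + S.sgn 𝕜 • S.adj (S.cj U₂ * (S.adj U₂ * (B * pinv X) * U₁) * U₁ᴴ)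
      + S.cj U₂ * (S.adj U₂ * (B * pinv X) * U₁) * U₁ᴴ := by
    rw [hblock₁, hblock₂, S.adj_sub, S.adj_mul (S.adj _), S.adj_adj, hblock₃]
    abel
  rw [hFsplit, ← hKM]
  have hμ0 : 0 ≤ specNorm (B * pinv X) := norm_nonneg (B * pinv X)
  generalize specNorm (B * pinv X) = μ at *
  generalize S.adj U₁ * (B * pinv X) * U₁ = a at *
  generalize S.adj U₂ * dilK S X B U₁ = K₂ at *
  have hca : S.cj a = S.sgn 𝕜 • aᴴ := by
    rw [StructClass.cj, haa, Matrix.conjTranspose_smul, S.star_sgn]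
  -- The involution carries the right defect of `a` to its left defect, so `N = adj M`.
  have hadjM : S.adj ((μ : 𝕜) ^ 2 • (1 : Matrix (Fin r) (Fin r) 𝕜) - aᴴ * a) =
      (μ : 𝕜) ^ 2 • (1 : Matrix (Fin r) (Fin r) 𝕜) - a * aᴴ := by
    rw [S.adj_sub, S.adj_smul_of_star_eq (by simp), S.adj_one, S.adj_mul, S.adj_conjTranspose, hca,
      haa, Matrix.smul_mul, Matrix.mul_smul, S.sgn_smul_sgn_smul]
  have hN := adj_psdSqrt S hMp
  have hNp := S.adj_posSemidef hMp
  rw [hadjM] at hN hNp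
  have hKp' := S.adj_posSemidef hK
  rw [S.adj_sub, S.adj_one, S.adj_mul, S.adj_conjTranspose] at hKp'
  have hV : S.cj U₁ * (S.cj U₁)ᴴ + S.cj U₂ * (S.cj U₂)ᴴ = 1 := by
    rw [S.conjTranspose_cj, S.conjTranspose_cj, hcUU, hcUV, add_sub_cancel]
  have hU : U₁ * U₁ᴴ + U₂ * U₂ᴴ = 1 := by rw [hU₁, hU₂, add_sub_cancel]
  have hmain := l2_opNorm_dilation_le (V₁ := S.cj U₁) (V₂ := S.cj U₂) (K := K₂)
    (L := S.sgn 𝕜 • S.adj K₂) (R := psdSqrt (1 - K₂ * K₂ᴴ))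
    (T := psdSqrt (1 - S.cj K₂ * S.adj K₂)) hμ0 hV hU (conjTranspose_psdSqrt _)
    (conjTranspose_psdSqrt _) (psdSqrt_mul_psdSqrt hMp) (psdSqrt_mul_psdSqrt hNp)
    (mul_psdSqrt_eq_psdSqrt_mul hMp hNp (by
      simp only [Matrix.mul_sub, Matrix.sub_mul, Matrix.mul_smul, Matrix.smul_mul, Matrix.mul_one,
        Matrix.one_mul, Matrix.mul_assoc])) hZ
    (by rw [conjTranspose_psdSqrt, psdSqrt_mul_psdSqrt hK])
    (by
      rw [conjTranspose_psdSqrt, psdSqrt_mul_psdSqrt hKp', Matrix.conjTranspose_smul,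
        S.conjTranspose_adj, S.star_sgn, Matrix.smul_mul, Matrix.mul_smul, S.sgn_smul_sgn_smul])
  refine le_trans (le_of_eq ?_) hmain
  rw [specNorm, ← hN]
  congr 1
  simp only [S.adj_mul, S.adj_cj, S.adj_conjTranspose, Matrix.mul_smul, Matrix.smul_mul,
    Matrix.mul_assoc, add_assoc]

/-- `B X† = A (X X†)`, and an orthogonal projection is a contraction. -/
theorem specNorm_mul_pinv_le {A : Matrix (Fin n) (Fin n) 𝕜} (hA : A * X = B) :
    specNorm (B * pinv X) ≤ specNorm A := by
  have hP : ‖X * pinv X‖ ≤ 1 := by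
    rw [l2_opNorm_le_one_iff_posSemidef, (pinv_spec X).isHermitian_left, mul_pinv_idem]
    have := Matrix.posSemidef_conjTranspose_mul_self (1 - X * pinv X)
    rwa [conjTranspose_one_sub_mul_pinv, one_sub_mul_pinv_idem] at this
  rw [← hA, Matrix.mul_assoc]
  exact (Matrix.l2_opNorm_mul _ _).trans (mul_le_of_le_one_right (norm_nonneg _) hP)

theorem specNorm_dilSol (hA : A ∈ solutions (S.matrices 𝕜 n) X B)
    (hU₁ : U₁ * U₁ᴴ = X * pinv X) (hU₂ : U₂ * U₂ᴴ = 1 - X * pinv X)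
    {Z : Matrix (Fin q) (Fin q) 𝕜} (hZs : Z ∈ S.matrices 𝕜 q) (hZ : specNorm Z ≤ 1) :
    specNorm (dilSol S X B U₁ U₂ Z) = specNorm (B * pinv X) :=
  le_antisymm (specNorm_dilSol_le hA hU₁ hU₂ hZ)
    (specNorm_mul_pinv_le (dilSol_mem hA hU₁ hU₂ hZs).2)

theorem sigma_specNorm (hne : (solutions (S.matrices 𝕜 n) X B).Nonempty) :
    sigma specNorm (S.matrices 𝕜 n) X B = specNorm (B * pinv X) := by
  obtain ⟨A₀, hA₀⟩ := hne
  -- The projections themselves serve as `U₁` and `U₂`, with `Z = 0`; no singular value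
  -- decomposition is needed.
  have h₁ : X * pinv X * (X * pinv X)ᴴ = X * pinv X := by
    rw [(pinv_spec X).isHermitian_left, mul_pinv_idem]
  have h₂ : (1 - X * pinv X) * (1 - X * pinv X)ᴴ = 1 - X * pinv X := by
    rw [conjTranspose_one_sub_mul_pinv, one_sub_mul_pinv_idem]
  have h0 : (0 : Matrix (Fin n) (Fin n) 𝕜) ∈ S.matrices 𝕜 n := S.mem_matrices_iff.2 (by simp)
  have h0' : specNorm (0 : Matrix (Fin n) (Fin n) 𝕜) ≤ 1 := by simp [specNorm]
  refine IsLeast.csInf_eq ⟨⟨_, dilSol_mem hA₀ h₁ h₂ h0, specNorm_dilSol hA₀ h₁ h₂ h0 h0'⟩, ?_⟩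
  rintro _ ⟨A, hA, rfl⟩
  exact specNorm_mul_pinv_le hA.2

theorem sigma_specNorm_univ (hA : A * X = B) :
    sigma specNorm Set.univ X B = specNorm (B * pinv X) := by
  -- The unstructured minimum is attained at `B X†` itself.
  refine IsLeast.csInf_eq ⟨⟨_, ⟨Set.mem_univ _, ?_⟩, rfl⟩, ?_⟩
  · rw [← hA, Matrix.mul_assoc, Matrix.mul_assoc, ← Matrix.mul_assoc X, (pinv_spec X).mul_mul_self]
  · rintro _ ⟨A, hA, rfl⟩
    exact specNorm_mul_pinv_le hA.2

end SpectralSolutions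

/-! ### Projections from a singular value decomposition -/

section SVD

variable {n p r : ℕ}

theorem sum_fin_split {M : Type*} [AddCommMonoid M] (h : r ≤ n) (f : Fin n → M) :
    ∑ j, f j = ∑ j : Fin r, f ⟨j, lt_of_lt_of_le j.2 h⟩
      + ∑ j : Fin (n - r), f ⟨r + j, by have := j.2; omega⟩ := by
  rw [← (finCongr (Nat.add_sub_cancel' h)).sum_comp f, Fin.sum_univ_add]
  rfl

theorem firstCols_add_lastCols (h : r ≤ n) (U : Matrix (Fin n) (Fin n) 𝕜) :
    firstCols h U * (firstCols h U)ᴴ + lastCols h U * (lastCols h U)ᴴ = U * Uᴴ := by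
  ext i k
  rw [Matrix.mul_apply (M := U), sum_fin_split h]
  rfl

/-- In a singular value decomposition the diagonal entries from the rank on vanish. -/
theorem IsSVD.apply_eq_zero {X U Sig V} (h : IsSVD (𝕜 := 𝕜) (n := n) (p := p) X U Sig V)
    {i : Fin n} (hi : X.rank ≤ i) (j : Fin p) : Sig i j = 0 := by
  obtain ⟨s, hs0, hsanti, hsig⟩ := h.diag
  rw [hsig]
  split_ifs with hij
  · by_contra hne
    have hpos : 0 < s i := lt_of_le_of_ne (hs0 _) fun h0 => hne (by rw [← h0, RCLike.ofReal_zero])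
    have hn : (i : ℕ) + 1 ≤ n := i.2
    have hp : (i : ℕ) + 1 ≤ p := hij ▸ j.2
    -- A positive entry at index `i` makes the leading block of size `i + 1` invertible, so the rank
    -- would exceed `i`.
    have hsub : Sig.submatrix (Fin.castLE hn) (Fin.castLE hp) =
        Matrix.diagonal fun t : Fin (i + 1) => ((s t : ℝ) : 𝕜) := by
      ext t t'
      simp [hsig, Matrix.diagonal_apply, Fin.ext_iff]
    have hrank : (Matrix.diagonal fun t : Fin (i + 1) => ((s t : ℝ) : 𝕜)).rank = i + 1 := by
      rw [Matrix.rank_of_isUnit, Fintype.card_fin]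
      rw [Matrix.isUnit_iff_isUnit_det, Matrix.det_diagonal, isUnit_iff_ne_zero,
        Finset.prod_ne_zero_iff]
      intro t _
      rw [RCLike.ofReal_ne_zero]
      exact (hpos.trans_le (hsanti (Nat.lt_succ_iff.1 t.2))).ne'
    have hSig : Sig = Uᴴ * (X * V) := by
      have hU : Uᴴ * U = 1 := Matrix.mem_unitaryGroup_iff'.1 h.unitary_left
      have hV : Vᴴ * V = 1 := Matrix.mem_unitaryGroup_iff'.1 h.unitary_right
      rw [h.eq_mul, Matrix.mul_assoc _ Vᴴ, hV, Matrix.mul_one, ← Matrix.mul_assoc, hU,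
        Matrix.one_mul]
    have hle : Sig.rank ≤ X.rank := by
      rw [hSig]
      exact (Matrix.rank_mul_le_right _ _).trans (Matrix.rank_mul_le_left _ _)
    have := Matrix.rank_submatrix_le Sig (Fin.castLE hn) (Fin.castLE hp)
    rw [hsub, hrank] at this
    omega
  · rfl

theorem IsSVD.lastCols_mul_eq_zero {X U Sig V}
    (h : IsSVD (𝕜 := 𝕜) (n := n) (p := p) X U Sig V) :
    (lastCols (rank_le_rows X) U)ᴴ * X = 0 := by
  have hU : Uᴴ * U = 1 := Matrix.mem_unitaryGroup_iff'.1 h.unitary_left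
  have h0 : (lastCols (rank_le_rows X) U)ᴴ * (U * Sig) = 0 := by
    ext j k
    have hj : (Uᴴ * (U * Sig)) ⟨X.rank + j, by have := j.2; omega⟩ k = 0 := by
      rw [← Matrix.mul_assoc, hU, Matrix.one_mul]
      exact h.apply_eq_zero (Nat.le_add_right _ _) k
    exact hj
  calc _ = (lastCols (rank_le_rows X) U)ᴴ * (U * Sig * Vᴴ) := congrArg _ h.eq_mul
    _ = 0 := by rw [← Matrix.mul_assoc, h0, Matrix.zero_mul]

/-- Orthogonal projections `P`, `P'` with `P' P = P` and `rank P' ≤ rank P` coincide. -/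
theorem eq_of_mul_eq_of_rank_le {P P' : Matrix (Fin n) (Fin n) 𝕜} (hPH : Pᴴ = P)
    (hP'H : P'ᴴ = P') (hP : P * P = P) (hPP : P' * P = P) (hr : P'.rank ≤ P.rank) : P' = P := by
  have hle : LinearMap.range P.mulVecLin ≤ LinearMap.range P'.mulVecLin := by
    rintro _ ⟨v, rfl⟩
    exact ⟨P *ᵥ v, by simp [hPP]⟩
  have heq := Submodule.eq_of_le_of_finrank_le hle hr
  have h : P * P' = P' := by
    apply Matrix.ext_of_mulVec_single
    intro i
    have : P'.mulVecLin (Pi.single i 1) ∈ LinearMap.range P.mulVecLin := heq ▸ ⟨_, rfl⟩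
    obtain ⟨w, hw⟩ := this
    simp only [Matrix.mulVecLin_apply] at hw
    rw [← Matrix.mulVec_mulVec, ← hw, Matrix.mulVec_mulVec, hP]
  have h' := congrArg Matrix.conjTranspose hPP
  rw [Matrix.conjTranspose_mul, hPH, hP'H, h] at h'
  exact h'

/-- `U₁ U₁ᴴ` fixes `X`, because `U₂ᴴ X = 0`, hence fixes `X X†`; its rank is at most `rank X`, so
the two projections agree. -/
theorem IsSVD.firstCols_mul_conjTranspose {X U Sig V}
    (h : IsSVD (𝕜 := 𝕜) (n := n) (p := p) X U Sig V) :
    firstCols (rank_le_rows X) U * (firstCols (rank_le_rows X) U)ᴴ = X * pinv X := by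
  have hsum := firstCols_add_lastCols (rank_le_rows X) U
  have hU : U * Uᴴ = 1 := Matrix.mem_unitaryGroup_iff.1 h.unitary_left
  rw [hU] at hsum
  have hX : firstCols (rank_le_rows X) U * (firstCols (rank_le_rows X) U)ᴴ * X = X := by
    rw [eq_sub_of_add_eq hsum, Matrix.sub_mul, Matrix.one_mul, Matrix.mul_assoc,
      h.lastCols_mul_eq_zero, Matrix.mul_zero, sub_zero]
  apply eq_of_mul_eq_of_rank_le (pinv_spec X).isHermitian_left _ (mul_pinv_idem X)
  · rw [← Matrix.mul_assoc, hX]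
  · calc _ ≤ (firstCols (rank_le_rows X) U).rank := Matrix.rank_mul_le_left _ _
      _ ≤ X.rank := by simpa using (firstCols (rank_le_rows X) U).rank_le_card_width
      _ = (X * pinv X * X).rank := by rw [(pinv_spec X).mul_mul_self]
      _ ≤ _ := Matrix.rank_mul_le_left _ _
  · simp

theorem IsSVD.lastCols_mul_conjTranspose {X U Sig V}
    (h : IsSVD (𝕜 := 𝕜) (n := n) (p := p) X U Sig V) :
    lastCols (rank_le_rows X) U * (lastCols (rank_le_rows X) U)ᴴ = 1 - X * pinv X := by
  have hU : U * Uᴴ = 1 := Matrix.mem_unitaryGroup_iff.1 h.unitary_left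
  rw [← h.firstCols_mul_conjTranspose, ← hU, ← firstCols_add_lastCols (rank_le_rows X) U,
    add_sub_cancel_left]

end SVD

end StructMap

end

/-! ### Assembly of the theorem -/

open StructMap in
theorem theorem3p5 {𝕜 : Type*} [RCLike 𝕜] {n p : ℕ} (S : StructClass)
    (X B : Matrix (Fin n) (Fin p) 𝕜) (hne : (solutions (S.matrices 𝕜 n) X B).Nonempty) :
    -- all solutions
    (∀ A : Matrix (Fin n) (Fin n) 𝕜, A ∈ solutions (S.matrices 𝕜 n) X B ↔
      ∃ Z ∈ S.matrices 𝕜 n,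
        A = solMap S X B + S.twist (1 - X * pinv X) * Z * (1 - X * pinv X)) ∧
    -- (a) Frobenius norm
    (solMap S X B ∈ solutions (S.matrices 𝕜 n) X B ∧
      sigma frobNorm (S.matrices 𝕜 n) X B = frobNorm (solMap S X B) ∧
      (∀ A ∈ solutions (S.matrices 𝕜 n) X B,
        frobNorm A = sigma frobNorm (S.matrices 𝕜 n) X B → A = solMap S X B) ∧
      ∃ t : ℝ,
        (t : 𝕜) = (B * pinv X * (B * pinv X)ᴴ * S.twist (X * pinv X)).trace ∧
        0 ≤ 2 * frobNorm (B * pinv X) ^ 2 - t ∧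
        frobNorm (solMap S X B) = Real.sqrt (2 * frobNorm (B * pinv X) ^ 2 - t)) ∧
    -- (b) spectral norm
    (sigma specNorm (S.matrices 𝕜 n) X B = specNorm (B * pinv X) ∧
      specNorm (B * pinv X) = sigma specNorm Set.univ X B ∧
      ∀ (U : Matrix (Fin n) (Fin n) 𝕜) (Sig : Matrix (Fin n) (Fin p) 𝕜)
        (V : Matrix (Fin p) (Fin p) 𝕜), IsSVD X U Sig V →
        ∀ Z ∈ S.matrices 𝕜 (n - X.rank), specNorm Z ≤ 1 →
          dilSol S X B (firstCols (rank_le_rows X) U) (lastCols (rank_le_rows X) U) Z ∈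
              solutions (S.matrices 𝕜 n) X B ∧
            specNorm (dilSol S X B (firstCols (rank_le_rows X) U)
              (lastCols (rank_le_rows X) U) Z) = sigma specNorm (S.matrices 𝕜 n) X B) := by
  have hne' := hne
  obtain ⟨A₀, hA₀⟩ := hne'
  -- The real `t` is the squared Frobenius norm of `adj P * G`, which makes the radicand equal to
  -- `‖𝓕(X, B)‖²`.
  refine ⟨fun A => mem_solutions_iff_exists hne,
    ⟨solMap_mem hA₀, sigma_frobNorm hne, fun A hA h => ?_, _, ofReal_frobNorm_adj_mul_sq X B,
      ?_, ?_⟩, sigma_specNorm hne, (sigma_specNorm_univ hA₀.2).symm, fun U Sig V h Z hZs hZ => ?_⟩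
  · exact eq_solMap_of_frobNorm_eq hA (h.trans (sigma_frobNorm hne))
  · rw [← frobNorm_solMap_sq hA₀]
    exact sq_nonneg _
  · rw [← frobNorm_solMap_sq hA₀, Real.sqrt_sq (frobNorm_nonneg _)]
  · refine ⟨dilSol_mem hA₀ h.firstCols_mul_conjTranspose h.lastCols_mul_conjTranspose hZs, ?_⟩
    rw [sigma_specNorm hne]
    exact specNorm_dilSol hA₀ h.firstCols_mul_conjTranspose h.lastCols_mul_conjTranspose hZs hZ
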